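/- A finite simple graph $G=(V,E)$ is a \emph{Laman graph} if $|E|=2|V|-3$ and every subgraph $(V',E')$ with $|V'|\ge 2$ satisfies $|E'|\le 2|V'|-3$. For a labeling $\lambda\colon E\to\mathbb{C}$, a \emph{compatible realization} is a map $\rho\colon V\to\mathbb{C}^2$ with $\langle\rho(u)-\rho(v),\rho(u)-\rho(v)\rangle=\lambda(\{u,v\})$ for all $\{u,v\}\in E$, where $\langle x,y\rangle=x_1y_1+x_2y_2$. Two realizations are \emph{equivalent} if they differ by a map $x\mapsto Ax+b$ with $A\in\mathbb{C}^{2\times 2}$, $AA^{T}=I$, $\det A=1$, $b\in\mathbb{C}^2$. The \emph{Laman number} $\operatorname{Lam}(G)$ is the number of equivalence classes of realizations compatible with $\lambda$ for a general labeling $\lambda$ (that is, for all $\lambda$ outside the zero set of some nonzero polynomial on $\mathbb{C}^E$). Let $M(n)$ be the largest Laman number among all Laman graphs with $n$ vertices. Let $G=(V,E)$ be a Laman graph. 1. If $|V|>2$, then for all $n\ge 2$ $$M(n)\;\ge\; 2^{(n-2)\bmod(|V|-2)}\cdot\operatorname{Lam}(G)^{\lfloor (n-2)/(|V|-2)\rfloor}.$$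 2. If $G$ contains a triangle and $|V|>3$, then for all $n\ge 3$ $$M(n)\;\ge\; 2^{(n-3)\bmod(|V|-3)}\cdot 2\cdot\left(\frac{\operatorname{Lam}(G)}{2}\right)^{\lfloor (n-3)/(|V|-3)\rfloor}.$$ 3. If $H=(W,F)$ is a subgraph of $G$ that is a Laman graph and $|W|<|V|$, then for all $n\ge |W|$ $$M(n)\;\ge\; 2^{(n-|W|)\bmod(|V|-|W|)}\cdot\operatorname{Lam}(H)\cdot\left(\frac{\operatorname{Lam}(G)}{\operatorname{Lam}(H)}\right)^{\lfloor (n-|W|)/(|V|-|W|)\rfloor}.$$ -/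

import Mathlib

namespace LamanCount

/-- A finite graph `G = (V, E)` is a Laman graph if `|E| = 2|V| - 3` and every subgraph
`(V', E')` with at least two vertices satisfies `|E'| ≤ 2|V'| - 3`. -/
def IsLaman {V : Type*} (G : SimpleGraph V) : Prop :=
  G.edgeSet.ncard + 3 = 2 * Nat.card V ∧
    ∀ G' : G.Subgraph, 2 ≤ G'.verts.ncard → G'.edgeSet.ncard + 3 ≤ 2 * G'.verts.ncard

/-- A realization of a graph with vertex set `V` in the complex plane. -/
abbrev Realization (V : Type*) := V → Fin 2 → ℂ

/-- `ρ` is compatible with the labeling `l` if `⟨ρ u - ρ v, ρ u - ρ v⟩ = l {u,v}` for all edges,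
where `⟨x, y⟩ = x₁y₁ + x₂y₂` is the (bilinear) standard form on `ℂ²`. -/
def Compatible {V : Type*} (G : SimpleGraph V) (l : G.edgeSet → ℂ) (ρ : Realization V) : Prop :=
  ∀ (u v : V) (h : G.Adj u v), (ρ u - ρ v) ⬝ᵥ (ρ u - ρ v) = l ⟨s(u, v), h⟩

/-- Two realizations are equivalent if they differ by a map `x ↦ A x + b` with `A` a complex
orthogonal matrix of determinant `1` (transpose, not conjugate transpose) and `b ∈ ℂ²`. -/
def Equivalent {V : Type*} (ρ τ : Realization V) : Prop :=
  ∃ (A : Matrix (Fin 2) (Fin 2) ℂ) (b : Fin 2 → ℂ),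
    A * A.transpose = 1 ∧ A.det = 1 ∧ ∀ v, τ v = A.mulVec (ρ v) + b

theorem Equivalent.equivalence (V : Type*) : Equivalence (Equivalent (V := V)) where
  refl ρ := ⟨1, 0, by simp, by simp, by simp⟩
  symm := by
    rintro ρ τ ⟨A, b, hA, hd, h⟩
    have hA' : A.transpose * A = 1 := mul_eq_one_comm.mp hA
    refine ⟨A.transpose, -(A.transpose.mulVec b), by simpa using hA', by simpa using hd, ?_⟩
    intro v
    rw [h v, Matrix.mulVec_add, Matrix.mulVec_mulVec, hA', Matrix.one_mulVec,
      add_neg_cancel_right]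
  trans := by
    rintro ρ τ κ ⟨A, b, hA, hd, h⟩ ⟨B, c, hB, he, k⟩
    refine ⟨B * A, B.mulVec b + c, ?_, by simp [hd, he], ?_⟩
    · rw [Matrix.transpose_mul, Matrix.mul_assoc, ← Matrix.mul_assoc A, hA, Matrix.one_mul, hB]
    · intro v
      rw [k v, h v, Matrix.mulVec_add, Matrix.mulVec_mulVec, add_assoc]

/-- Equivalence, restricted to the realizations compatible with a given labeling. -/
def realizationSetoid {V : Type*} (G : SimpleGraph V) (l : G.edgeSet → ℂ) :
    Setoid {ρ : Realization V // Compatible G l ρ} where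
  r ρ τ := Equivalent ρ.1 τ.1
  iseqv := ⟨fun _ => (Equivalent.equivalence V).refl _,
    fun h => (Equivalent.equivalence V).symm h,
    fun h k => (Equivalent.equivalence V).trans h k⟩

/-- The number (possibly infinite) of realizations compatible with `l`, up to equivalence. -/
noncomputable def numRealizations {V : Type*} (G : SimpleGraph V) (l : G.edgeSet → ℂ) : ℕ∞ :=
  ENat.card (Quotient (realizationSetoid G l))

/-- For a general labeling (outside the zero set of some nonzero polynomial in the labels),
`G` has exactly `N` compatible realizations up to equivalence. -/
def IsGenericCount {V : Type*} (G : SimpleGraph V) (N : ℕ) : Prop :=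
  ∃ P : MvPolynomial G.edgeSet ℂ, P ≠ 0 ∧
    ∀ l : G.edgeSet → ℂ, MvPolynomial.eval l P ≠ 0 → numRealizations G l = N

/-- The generic number of realizations is unique. -/
theorem IsGenericCount.unique {V : Type*} {G : SimpleGraph V} {N M : ℕ}
    (hN : IsGenericCount G N) (hM : IsGenericCount G M) : N = M := by
  obtain ⟨P, hP, hP'⟩ := hN
  obtain ⟨Q, hQ, hQ'⟩ := hM
  have hPQ : P * Q ≠ 0 := mul_ne_zero hP hQ
  obtain ⟨l, hl⟩ : ∃ l, MvPolynomial.eval l (P * Q) ≠ 0 := by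
    by_contra! h
    exact hPQ (MvPolynomial.funext fun l => by simpa using h l)
  rw [map_mul] at hl
  have h := (hP' l (left_ne_zero_of_mul hl)).symm.trans (hQ' l (right_ne_zero_of_mul hl))
  exact_mod_cast h

/-- The Laman number: the number of compatible realizations, up to equivalence, for a general
labeling (the infimum is over a set with at most one element). -/
noncomputable def lam {V : Type*} (G : SimpleGraph V) : ℕ :=
  sInf {N : ℕ | IsGenericCount G N}

/-- The largest Laman number among all Laman graphs with `n` vertices. -/
noncomputable def maxLam (n : ℕ) : ℕ :=
  sSup {N : ℕ | ∃ G : SimpleGraph (Fin n), IsLaman G ∧ lam G = N}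

/-- The set defining `maxLam n` is finite, so that the supremum is a maximum when some Laman graph
with `n` vertices exists. -/
theorem finite_lamanNumbers (n : ℕ) :
    {N : ℕ | ∃ G : SimpleGraph (Fin n), IsLaman G ∧ lam G = N}.Finite :=
  (Set.finite_range fun G : SimpleGraph (Fin n) => lam G).subset fun _ ⟨G, _, h⟩ => ⟨G, h⟩

end LamanCount

/-! Copies of `G` are glued along a Laman subgraph `H` on `W`. If each general realization of `H`
extends to the same number `c` of realizations of `G`, then Lam(G) = Lam(H)·c, and every further
copy adds |V| - |W| vertices and multiplies the count by `c`. Leftover vertices come from triangles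
glued along an edge, each doubling the count. The first two bounds are the cases where `H` is an
edge (count 1) or a triangle (count 2).

The crux is that `c` does not depend on the realization of `H`. Fixing an anchor removes the
three-dimensional motion group, so realizing `H` means solving a polynomial system with 2|W| =
|E(H)| + 3 unknowns and equations (`isGenericCount_iff`). If the system is dominant, its components
form a transcendence basis, and every nonzero polynomial divides a nonzero polynomial in the
components. Hence whole general fibres avoid any given hypersurface (`Generic.forall_fibre`). By
Chevalley and the Nullstellensatz, having at least `m` extensions is generically true or generically
false (`generic_le_enatCard_or_not`), so the number of extensions is constant on general fibres
(`exists_generic_extension_count`). New vertices of different copies share no edge, so extension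
numbers multiply (`exists_generic_glued_count`); sparsity survives by `isLaman_glue`.

Existence of a generic count is never needed for arbitrary Laman graphs: without one `lam` is 0, and
then the bound is trivial or does not involve `G`. -/

namespace LamanCount

/-! ### Generic properties on affine space -/

/-- A property of points of `ℂ^ι` holds generically if it holds outside the zero set of some
nonzero polynomial. -/
def Generic {ι : Type*} (p : (ι → ℂ) → Prop) : Prop :=
  ∃ P : MvPolynomial ι ℂ, P ≠ 0 ∧ ∀ x, MvPolynomial.eval x P ≠ 0 → p x

theorem exists_eval_ne_zero {ι : Type*} {P : MvPolynomial ι ℂ} (hP : P ≠ 0) :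
    ∃ x, MvPolynomial.eval x P ≠ 0 := by
  by_contra! h
  exact hP (MvPolynomial.funext fun x => by simpa using h x)

theorem eval_aeval {σ τ : Type*} (Ψ : τ → MvPolynomial σ ℂ) (x : σ → ℂ) (Q : MvPolynomial τ ℂ) :
    MvPolynomial.eval x (MvPolynomial.aeval Ψ Q) =
      MvPolynomial.eval (fun j => MvPolynomial.eval x (Ψ j)) Q := by
  induction Q using MvPolynomial.induction_on with
  | C a => simp
  | add p q hp hq => rw [map_add, map_add, map_add, hp, hq]
  | mul_X p i hp => rw [map_mul, map_mul, map_mul, hp, MvPolynomial.aeval_X, MvPolynomial.eval_X]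

namespace Generic

variable {ι κ : Type*} {p q : (ι → ℂ) → Prop}

theorem mono (h : Generic p) (hpq : ∀ x, p x → q x) : Generic q :=
  h.imp fun _ hP => ⟨hP.1, fun x hx => hpq x (hP.2 x hx)⟩

theorem and (hp : Generic p) (hq : Generic q) : Generic fun x => p x ∧ q x := by
  obtain ⟨P, hP, hP'⟩ := hp
  obtain ⟨Q, hQ, hQ'⟩ := hq
  refine ⟨P * Q, mul_ne_zero hP hQ, fun x hx => ?_⟩
  rw [map_mul] at hx
  exact ⟨hP' x (left_ne_zero_of_mul hx), hQ' x (right_ne_zero_of_mul hx)⟩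

theorem exists_point (hp : Generic p) : ∃ x, p x := by
  obtain ⟨P, hP, hP'⟩ := hp
  exact (exists_eval_ne_zero hP).imp hP'

theorem of_eval_ne_zero {P : MvPolynomial ι ℂ} (hP : P ≠ 0) :
    Generic fun x => MvPolynomial.eval x P ≠ 0 :=
  ⟨P, hP, fun _ hx => hx⟩

theorem apply_ne_zero (i : ι) : Generic fun x : ι → ℂ => x i ≠ 0 :=
  (of_eval_ne_zero (MvPolynomial.X_ne_zero i)).mono fun x hx => by simpa using hx

/-- Genericity is preserved under pulling back along a projection of coordinates. -/
theorem comp_injective (hp : Generic p) {f : ι → κ} (hf : Function.Injective f) :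
    Generic fun y : κ → ℂ => p (y ∘ f) := by
  obtain ⟨P, hP, hP'⟩ := hp
  refine ⟨MvPolynomial.rename f P, ?_, fun y hy => hP' _ ?_⟩
  · rwa [Ne, map_eq_zero_iff _ (MvPolynomial.rename_injective f hf)]
  · rwa [MvPolynomial.eval_rename] at hy

/-- Fixing suitable values of some of the coordinates preserves genericity. -/
theorem exists_section {p : (ι ⊕ κ → ℂ) → Prop} (hp : Generic p) :
    Generic fun s : κ → ℂ => Generic fun x : ι → ℂ => p (Sum.elim x s) := by
  obtain ⟨P, hP, hP'⟩ := hp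
  obtain ⟨z, hz⟩ := exists_eval_ne_zero hP
  let F (x : ι → ℂ) : MvPolynomial κ ℂ :=
    MvPolynomial.aeval (Sum.elim (fun i => MvPolynomial.C (x i)) MvPolynomial.X) P
  let F' (s : κ → ℂ) : MvPolynomial ι ℂ :=
    MvPolynomial.aeval (Sum.elim MvPolynomial.X (fun i => MvPolynomial.C (s i))) P
  have hF (x s) : MvPolynomial.eval s (F x) = MvPolynomial.eval (Sum.elim x s) P := by
    rw [eval_aeval]
    congr 2
    funext i
    cases i <;> simp
  have hF' (x s) : MvPolynomial.eval x (F' s) = MvPolynomial.eval (Sum.elim x s) P := by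
    rw [eval_aeval]
    congr 2
    funext i
    cases i <;> simp
  have hz' : MvPolynomial.eval (Sum.elim (z ∘ Sum.inl) (z ∘ Sum.inr)) P ≠ 0 := by
    rwa [Sum.elim_comp_inl_inr]
  -- Where the slice of `P` through the `ι`-part of `z` is nonzero at `s`, that same `ι`-part
  -- witnesses that the slice of `P` at `s` is a nonzero polynomial.
  refine ⟨F (z ∘ Sum.inl), fun h0 => hz' (by rw [← hF, h0, map_zero]), fun s hs => ?_⟩
  rw [hF] at hs
  exact ⟨F' s, fun h0 => hs (by rw [← hF', h0, map_zero]), fun x hx => hP' _ (by rwa [← hF'])⟩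

end Generic

/-! ### Chevalley's theorem and the Nullstellensatz -/

section Chevalley

open PrimeSpectrum Topology

/-- A constructible subset of an irreducible affine scheme contains or misses a nonempty open
subset. -/
theorem exists_basicOpen_subset_or_disjoint {A : Type*} [CommRing A] [IsDomain A]
    {s : Set (PrimeSpectrum A)} (hs : IsConstructible s) :
    ∃ P : A, P ≠ 0 ∧ ((basicOpen P : Set (PrimeSpectrum A)) ⊆ s ∨
      (basicOpen P : Set (PrimeSpectrum A)) ⊆ sᶜ) := by
  induction hs using IsConstructible.empty_union_induction with
  | open_retrocompact U hU _ =>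
    rcases U.eq_empty_or_nonempty with rfl | ⟨x, hx⟩
    · exact ⟨1, one_ne_zero, Or.inr (by simp)⟩
    · obtain ⟨_, ⟨P, rfl⟩, hxP, hPU⟩ :=
        isTopologicalBasis_basic_opens.exists_subset_of_mem_open hx hU
      refine ⟨P, ?_, Or.inl hPU⟩
      rintro rfl
      simp at hxP
  | union s _ t _ ihs iht =>
    obtain ⟨P, hP, hPs⟩ := ihs
    obtain ⟨Q, hQ, hQt⟩ := iht
    rcases hPs with hPs | hPs
    · exact ⟨P, hP, Or.inl (hPs.trans Set.subset_union_left)⟩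
    rcases hQt with hQt | hQt
    · exact ⟨Q, hQ, Or.inl (hQt.trans Set.subset_union_right)⟩
    -- Irreducibility enters here: in a domain two nonempty basic opens meet in a nonempty one.
    refine ⟨P * Q, mul_ne_zero hP hQ, Or.inr ?_⟩
    rw [basicOpen_mul, Set.compl_union]
    exact Set.inter_subset_inter hPs hQt
  | compl s _ ih =>
    obtain ⟨P, hP, h⟩ := ih
    exact ⟨P, hP, by rw [compl_compl]; exact h.symm⟩

/-- The projection of an algebraic set either contains a general point or misses a general
point. -/
theorem generic_exists_or_not {ι κ : Type*} [Finite ι] [Finite κ]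
    (S : Set (MvPolynomial (ι ⊕ κ) ℂ)) :
    (Generic fun x : ι → ℂ => ∃ y : κ → ℂ, ∀ F ∈ S, MvPolynomial.eval (Sum.elim x y) F = 0) ∨
    (Generic fun x : ι → ℂ => ¬ ∃ y : κ → ℂ, ∀ F ∈ S, MvPolynomial.eval (Sum.elim x y) F = 0) := by
  let f : MvPolynomial ι ℂ →ₐ[ℂ] MvPolynomial (ι ⊕ κ) ℂ := MvPolynomial.rename Sum.inl
  have hf : (f : MvPolynomial ι ℂ →+* MvPolynomial (ι ⊕ κ) ℂ).FinitePresentation := by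
    refine RingHom.FinitePresentation.of_comp_finiteType (algebraMap ℂ (MvPolynomial ι ℂ)) ?_ ?_
    · rw [AlgHom.comp_algebraMap, RingHom.finitePresentation_algebraMap]
      infer_instance
    · rw [RingHom.finiteType_algebraMap]
      infer_instance
  have hS : IsConstructible (zeroLocus S) := by
    rw [← isConstructible_compl]
    exact (TopologicalSpace.NoetherianSpace.isCompact _).isConstructible
      (isClosed_zeroLocus S).isOpen_compl
  obtain ⟨P, hP, h⟩ := exists_basicOpen_subset_or_disjoint (isConstructible_comap_image hf hS)
  refine h.imp (fun h => ⟨P, hP, fun x hx => ?_⟩) (fun h => ⟨P, hP, ?_⟩)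
  · let m : PrimeSpectrum (MvPolynomial ι ℂ) :=
      ⟨RingHom.ker (MvPolynomial.eval x), RingHom.ker_isPrime _⟩
    obtain ⟨q, hqS, hqm⟩ := h (show m ∈ basicOpen P from hx)
    -- The prime `q` over `x` need not be closed. A maximal ideal above it is a point `z` by the
    -- Nullstellensatz, and `z` still lies over `x` because `q` contains every `X i - x i`.
    obtain ⟨M, hM, hqM⟩ := q.asIdeal.exists_le_maximal q.isPrime.ne_top
    obtain ⟨z, hz⟩ := MvPolynomial.eq_vanishingIdeal_singleton_of_isMaximal ℂ hM
    have hev (F) (hF : F ∈ q.asIdeal) : MvPolynomial.eval z F = 0 := by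
      have h1 := hqM hF
      rw [hz, MvPolynomial.mem_vanishingIdeal_singleton_iff] at h1
      simpa using h1
    have hzx : z ∘ Sum.inl = x := by
      funext i
      have h1 : (MvPolynomial.X i - MvPolynomial.C (x i) : MvPolynomial ι ℂ) ∈ m.asIdeal := by
        simp [m, RingHom.mem_ker]
      rw [← hqm] at h1
      have h2 := hev _ h1
      simpa [f, sub_eq_zero] using h2
    refine ⟨z ∘ Sum.inr, fun F hF => ?_⟩
    rw [← hzx, Sum.elim_comp_inl_inr]
    exact hev F (hqS hF)
  · rintro x hx ⟨y, hy⟩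
    let m : PrimeSpectrum (MvPolynomial ι ℂ) :=
      ⟨RingHom.ker (MvPolynomial.eval x), RingHom.ker_isPrime _⟩
    refine h (show m ∈ basicOpen P from hx)
      ⟨⟨RingHom.ker (MvPolynomial.eval (Sum.elim x y)), RingHom.ker_isPrime _⟩,
        fun F hF => hy F hF, ?_⟩
    ext F
    simp [m, f, RingHom.mem_ker, MvPolynomial.eval_rename]

end Chevalley

/-! ### Polynomial maps and their general fibres -/

/-- A polynomial function on `ℂ^ι`. -/
def IsPolyFun {ι : Type*} (f : (ι → ℂ) → ℂ) : Prop :=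
  ∃ P : MvPolynomial ι ℂ, ∀ x, MvPolynomial.eval x P = f x

namespace IsPolyFun

variable {ι κ : Type*} {f g : (ι → ℂ) → ℂ}

theorem coord (i : ι) : IsPolyFun fun x : ι → ℂ => x i := ⟨MvPolynomial.X i, by simp⟩

theorem const (c : ℂ) : IsPolyFun fun _ : ι → ℂ => c := ⟨MvPolynomial.C c, by simp⟩

theorem add (hf : IsPolyFun f) (hg : IsPolyFun g) : IsPolyFun fun x => f x + g x := by
  obtain ⟨P, hP⟩ := hf
  obtain ⟨Q, hQ⟩ := hg
  exact ⟨P + Q, by simp [hP, hQ]⟩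

theorem sub (hf : IsPolyFun f) (hg : IsPolyFun g) : IsPolyFun fun x => f x - g x := by
  obtain ⟨P, hP⟩ := hf
  obtain ⟨Q, hQ⟩ := hg
  exact ⟨P - Q, by simp [hP, hQ]⟩

theorem mul (hf : IsPolyFun f) (hg : IsPolyFun g) : IsPolyFun fun x => f x * g x := by
  obtain ⟨P, hP⟩ := hf
  obtain ⟨Q, hQ⟩ := hg
  exact ⟨P * Q, by simp [hP, hQ]⟩

theorem sum {α : Type*} (s : Finset α) {f : α → (ι → ℂ) → ℂ} (hf : ∀ a, IsPolyFun (f a)) :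
    IsPolyFun fun x => ∑ a ∈ s, f a x := by
  choose P hP using hf
  exact ⟨∑ a ∈ s, P a, by simp [hP]⟩

theorem comp (hf : IsPolyFun f) (e : ι → κ) : IsPolyFun fun y : κ → ℂ => f (y ∘ e) := by
  obtain ⟨P, hP⟩ := hf
  exact ⟨MvPolynomial.rename e P, fun y => by rw [MvPolynomial.eval_rename, hP]⟩

end IsPolyFun

/-- The projection of an algebraic set either contains a general point or misses a general
point. -/
theorem generic_exists_or_not_of_isPolyFun {ι κ α : Type*} [Finite ι] [Finite κ]
    {F : α → (ι ⊕ κ → ℂ) → ℂ} (hF : ∀ a, IsPolyFun (F a)) :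
    (Generic fun x : ι → ℂ => ∃ y : κ → ℂ, ∀ a, F a (Sum.elim x y) = 0) ∨
    (Generic fun x : ι → ℂ => ¬ ∃ y : κ → ℂ, ∀ a, F a (Sum.elim x y) = 0) := by
  choose P hP using hF
  simpa [hP] using generic_exists_or_not (Set.range P)

/-- If a polynomial map between affine spaces of the same dimension is dominant, then all points
of the fibre over a general point are general. -/
theorem Generic.forall_fibre {σ τ : Type*} [Fintype σ] [Fintype τ]
    (hcard : Fintype.card τ = Fintype.card σ) {Φ : (σ → ℂ) → τ → ℂ}
    (hΦ : ∀ j, IsPolyFun fun x => Φ x j) (hdom : Generic fun t => ∃ x, Φ x = t)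
    {p : (σ → ℂ) → Prop} (hp : Generic p) :
    Generic fun t => ∀ x, Φ x = t → p x := by
  choose Ψ hΨ using hΦ
  have hev (x) (Q : MvPolynomial τ ℂ) :
      MvPolynomial.eval x (MvPolynomial.aeval Ψ Q) = MvPolynomial.eval (Φ x) Q := by
    rw [eval_aeval]
    congr 2
    exact funext fun j => hΨ j x
  -- A relation among the components would vanish on the image, which contains general points.
  have hind : AlgebraicIndependent ℂ Ψ := by
    rw [algebraicIndependent_iff]
    intro Q hQ
    by_contra hQ0
    obtain ⟨t, ⟨x, rfl⟩, ht⟩ := (hdom.and (Generic.of_eval_ne_zero hQ0)).exists_point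
    exact ht (by rw [← hev, hQ, map_zero])
  have hbasis : IsTranscendenceBasis ℂ Ψ := by
    refine hind.isTranscendenceBasis_of_lift_trdeg_le_of_finite ?_
    simp [MvPolynomial.trdeg_of_isDomain, hcard]
  have halg := hbasis.isAlgebraic
  obtain ⟨P, hP, hP'⟩ := hp
  -- `P` is algebraic over the subalgebra generated by the components, so some nonzero multiple `r`
  -- of `P` lies in it. Writing `r` as `Q` in the components, `P` has no zero on the fibre over `t`
  -- once `Q` is nonzero at `t`.
  obtain ⟨r, hr, S, hS⟩ :=
    (halg.1 P).exists_nonzero_dvd (mem_nonZeroDivisors_of_ne_zero hP)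
  obtain ⟨Q, hQ⟩ : ∃ Q, MvPolynomial.aeval Ψ Q = (r : MvPolynomial σ ℂ) := by
    exact (Algebra.adjoin_range_eq_range_aeval ℂ Ψ).le r.2
  refine ⟨Q, ?_, ?_⟩
  · rintro rfl
    exact hr (Subtype.ext (by simpa using hQ.symm))
  · rintro _ ht x rfl
    refine hP' x fun h0 => ht ?_
    rw [← hev, hQ]
    change MvPolynomial.eval x (algebraMap _ _ r) = 0
    rw [hS, map_mul, h0, zero_mul]

/-! ### Counting solutions -/

/-- Turns a lower bound on a possibly infinite count into an existential statement, the form to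
which elimination applies. -/
theorem natCast_le_enatCard_iff {α : Type*} (m : ℕ) :
    (m : ℕ∞) ≤ ENat.card α ↔ ∃ y : Fin m → α, Function.Injective y := by
  constructor
  · intro h
    rcases finite_or_infinite α with hα | hα
    · have := Fintype.ofFinite α
      rw [ENat.card_eq_coe_fintype_card, Nat.cast_le, ← Fintype.card_fin m] at h
      obtain ⟨f⟩ := Function.Embedding.nonempty_of_card_le h
      exact ⟨f, f.injective⟩
    · exact ⟨_, ((Fin.valEmbedding (n := m)).trans (Infinite.natEmbedding α)).injective⟩
  · rintro ⟨y, hy⟩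
    have := ENat.card_le_card_of_injective hy
    simpa using this

theorem enatCard_sigma_of_forall_eq {α : Type*} {β : α → Type*} {c : ℕ}
    (h : ∀ a, ENat.card (β a) = c) : ENat.card (Σ a, β a) = ENat.card α * c := by
  have e (a) : Nonempty (β a ≃ Fin c) := by
    have : Finite (β a) := by
      rw [← ENat.card_lt_top, h]
      exact ENat.natCast_lt_top c
    have := Fintype.ofFinite (β a)
    have h' := h a
    rw [ENat.card_eq_coe_fintype_card, Nat.cast_inj] at h'
    exact ⟨Fintype.equivFinOfCardEq h'⟩
  replace e (a) := (e a).some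
  rw [ENat.card_congr ((Equiv.sigmaCongrRight e).trans (Equiv.sigmaEquivProd _ _)), ENat.card_prod]
  simp

/-- The number of solutions of a triangular system. -/
theorem enatCard_triangular {α β : Type*} {p : α → Prop} {q : α → β → Prop} {c : ℕ}
    (h : ∀ x, p x → ENat.card {y // q x y} = c) :
    ENat.card {z : α × β // p z.1 ∧ q z.1 z.2} = ENat.card {x // p x} * c := by
  let e : {z : α × β // p z.1 ∧ q z.1 z.2} ≃ Σ x : {x // p x}, {y // q x.1 y} :=
    { toFun z := ⟨⟨z.1.1, z.2.1⟩, ⟨z.1.2, z.2.2⟩⟩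
      invFun z := ⟨(z.1.1, z.2.1), z.1.2, z.2.2⟩ }
  rw [ENat.card_congr e]
  exact enatCard_sigma_of_forall_eq fun x => h x.1 x.2

/-- Tuples with pairwise distinct entries are described by polynomial equations in additional
variables. -/
theorem injective_iff_exists_sum_mul {m : ℕ} {σ : Type*} [Fintype σ] (y : Fin m → σ → ℂ) :
    Function.Injective y ↔
      ∃ w : Fin m → Fin m → σ → ℂ, ∀ i j, i ≠ j → ∑ c, w i j c * (y i c - y j c) = 1 := by
  classical
  constructor
  · intro hy
    have hex (i j : Fin m) : ∃ w : σ → ℂ, i ≠ j → ∑ c, w c * (y i c - y j c) = 1 := by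
      by_cases hij : i = j
      · exact ⟨0, fun h => absurd hij h⟩
      obtain ⟨c, hc⟩ := Function.ne_iff.mp (hy.ne hij)
      refine ⟨Pi.single c (y i c - y j c)⁻¹, fun _ => ?_⟩
      rw [Finset.sum_eq_single c]
      · rw [Pi.single_eq_same, inv_mul_cancel₀ (sub_ne_zero.mpr hc)]
      · intro b _ hb
        rw [Pi.single_eq_of_ne hb, zero_mul]
      · simp
    choose w hw using hex
    exact ⟨w, hw⟩
  · rintro ⟨w, hw⟩ i j hij
    by_contra hne
    have := hw i j hne
    simp [hij] at this

/-- A nonzero generic count makes general fibres nonempty; this is how dominance is obtained. -/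
theorem Generic.exists_of_enatCard_eq {σ τ : Type*} {Φ : (σ → ℂ) → τ → ℂ} {h : ℕ} (h0 : h ≠ 0)
    (hh : Generic fun t => ENat.card {x // Φ x = t} = h) : Generic fun t => ∃ x, Φ x = t :=
  hh.mono fun t ht => by
    by_contra! hne
    have : IsEmpty {x // Φ x = t} := ⟨fun x => hne x.1 x.2⟩
    rw [ENat.card_eq_zero_iff_empty _ |>.mpr this] at ht
    exact h0 (by exact_mod_cast ht.symm)

/-! ### Extending the solutions of a base system -/

section Extension

variable {σ₀ σ₁ σ₂ τ₀ τ₁ τ₂ : Type*} [Fintype σ₀] [Fintype σ₁] [Fintype τ₀]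
  [Fintype τ₁] {Φ : (σ₀ → ℂ) → τ₀ → ℂ} {Ψ : (σ₀ → ℂ) → (σ₁ → ℂ) → τ₁ → ℂ}

/-- The number of solutions of a polynomial system is either generically at least `m` or
generically less than `m`. -/
theorem generic_le_enatCard_or_not (m : ℕ)
    (hΨ : ∀ j, IsPolyFun fun z : σ₀ ⊕ σ₁ → ℂ => Ψ (z ∘ Sum.inl) (z ∘ Sum.inr) j) :
    (Generic fun s : σ₀ ⊕ τ₁ → ℂ =>
      (m : ℕ∞) ≤ ENat.card {y // Ψ (s ∘ Sum.inl) y = s ∘ Sum.inr}) ∨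
    (Generic fun s : σ₀ ⊕ τ₁ → ℂ =>
      ¬ (m : ℕ∞) ≤ ENat.card {y // Ψ (s ∘ Sum.inl) y = s ∘ Sum.inr}) := by
  let ι := σ₀ ⊕ τ₁
  -- The unknowns to eliminate are `m` candidate solutions and, for each pair of them, a vector
  -- certifying that the two are distinct.
  let κ := (Fin m × σ₁) ⊕ (Fin m × Fin m × σ₁)
  let F : (Fin m × τ₁) ⊕ {p : Fin m × Fin m // p.1 ≠ p.2} → (ι ⊕ κ → ℂ) → ℂ :=
    Sum.elim
      (fun a z => Ψ (fun i => z (Sum.inl (Sum.inl i)))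
        (fun c => z (Sum.inr (Sum.inl (a.1, c)))) a.2 - z (Sum.inl (Sum.inr a.2)))
      (fun p z => ∑ c, z (Sum.inr (Sum.inr (p.1.1, p.1.2, c))) *
        (z (Sum.inr (Sum.inl (p.1.1, c))) - z (Sum.inr (Sum.inl (p.1.2, c)))) - 1)
  have hF (a) : IsPolyFun (F a) := by
    rcases a with a | p
    · exact ((hΨ a.2).comp (Sum.elim (fun i => Sum.inl (Sum.inl i))
        (fun c => Sum.inr (Sum.inl (a.1, c))))).sub (.coord _)
    · exact (IsPolyFun.sum _ fun c => (IsPolyFun.coord _).mul ((IsPolyFun.coord _).sub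
        (.coord _))).sub (.const 1)
  have key (s : ι → ℂ) : (∃ y : κ → ℂ, ∀ a, F a (Sum.elim s y) = 0) ↔
      (m : ℕ∞) ≤ ENat.card {y // Ψ (s ∘ Sum.inl) y = s ∘ Sum.inr} := by
    rw [natCast_le_enatCard_iff]
    constructor
    · rintro ⟨y, hy⟩
      refine ⟨fun i => ⟨fun c => y (Sum.inl (i, c)), ?_⟩, ?_⟩
      · funext j
        have := hy (Sum.inl (i, j))
        exact sub_eq_zero.mp this
      · have : Function.Injective fun (i : Fin m) (c : σ₁) => y (Sum.inl (i, c)) := by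
          rw [injective_iff_exists_sum_mul]
          refine ⟨fun i j c => y (Sum.inr (i, j, c)), fun i j hij => ?_⟩
          have := hy (Sum.inr ⟨(i, j), hij⟩)
          exact sub_eq_zero.mp this
        intro i j hij
        exact this (congrArg Subtype.val hij)
    · rintro ⟨y, hy⟩
      obtain ⟨w, hw⟩ := (injective_iff_exists_sum_mul fun i => (y i).1).mp
        (Subtype.val_injective.comp hy)
      refine ⟨Sum.elim (fun q => (y q.1).1 q.2) (fun q => w q.1 q.2.1 q.2.2), ?_⟩
      rintro (a | p)
      · exact sub_eq_zero.mpr (congrFun (y a.1).2 a.2)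
      · exact sub_eq_zero.mpr (hw p.1.1 p.1.2 p.2)
  simpa only [key] using generic_exists_or_not_of_isPolyFun hF

/-- For a dominant polynomial map `Φ` between affine spaces of the same dimension, a property of a
general point of the source and a general parameter holds for all points of a general fibre. -/
theorem Generic.forall_fibre_sum (hcard : Fintype.card τ₀ = Fintype.card σ₀)
    (hΦ : ∀ j, IsPolyFun fun x => Φ x j) (hdom : Generic fun t => ∃ x, Φ x = t)
    {p : (σ₀ ⊕ τ₁ → ℂ) → Prop} (hp : Generic p) :
    Generic fun t : τ₀ ⊕ τ₁ → ℂ => ∀ x, Φ x = t ∘ Sum.inl → p (Sum.elim x (t ∘ Sum.inr)) := by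
  -- The parameters in `τ₁` are carried along by the identity, which keeps the map dominant and the
  -- dimensions equal.
  refine (Generic.forall_fibre (Φ := fun s : σ₀ ⊕ τ₁ → ℂ =>
    Sum.elim (Φ (s ∘ Sum.inl)) (s ∘ Sum.inr)) (by simp [hcard]) ?_ ?_ hp).mono ?_
  · rintro (j | j)
    · exact (hΦ j).comp Sum.inl
    · exact .coord (Sum.inr j)
  · refine (hdom.comp_injective Sum.inl_injective).mono ?_
    rintro t ⟨x, hx⟩
    exact ⟨Sum.elim x (t ∘ Sum.inr), by simp [hx]⟩
  · intro t ht x hx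
    exact ht _ (by simp [hx])

/-- All points of a general fibre of `Φ` have the same number of extensions to solutions of
`(Φ, Ψ)`. -/
theorem exists_generic_extension_count (hcard : Fintype.card τ₀ = Fintype.card σ₀)
    (hΦ : ∀ j, IsPolyFun fun x => Φ x j)
    (hΨ : ∀ j, IsPolyFun fun z : σ₀ ⊕ σ₁ → ℂ => Ψ (z ∘ Sum.inl) (z ∘ Sum.inr) j)
    {h g : ℕ} (h0 : h ≠ 0) (hh : Generic fun t => ENat.card {x // Φ x = t} = h)
    (hg : Generic fun t : τ₀ ⊕ τ₁ → ℂ => ENat.card {z : (σ₀ → ℂ) × (σ₁ → ℂ) //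
      Φ z.1 = t ∘ Sum.inl ∧ Ψ z.1 z.2 = t ∘ Sum.inr} = g) :
    ∃ c : ℕ, g = h * c ∧ Generic fun t : τ₀ ⊕ τ₁ → ℂ =>
      ∀ x, Φ x = t ∘ Sum.inl → ENat.card {y // Ψ x y = t ∘ Sum.inr} = c := by
  classical
  have hdom := Generic.exists_of_enatCard_eq h0 hh
  let L (m : ℕ) : Prop := Generic fun s : σ₀ ⊕ τ₁ → ℂ =>
    (m : ℕ∞) ≤ ENat.card {y // Ψ (s ∘ Sum.inl) y = s ∘ Sum.inr}
  have hL0 : L 0 := (Generic.of_eval_ne_zero one_ne_zero).mono fun _ _ => by simp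
  -- Over a general target every base solution would have more than `g` extensions, already
  -- exceeding the total; a base solution exists by dominance.
  have hLg : ¬ L (g + 1) := by
    intro hL
    obtain ⟨t, ⟨ht1, x, hx⟩, ht2⟩ := (((Generic.forall_fibre_sum hcard hΦ hdom hL).and
      (hdom.comp_injective Sum.inl_injective)).and hg).exists_point
    have h1 := ht1 x hx
    simp only [Sum.elim_comp_inl, Sum.elim_comp_inr] at h1
    have h2 := ENat.card_le_card_of_injective (f := fun y : {y // Ψ x y = t ∘ Sum.inr} =>
      (⟨(x, y.1), hx, y.2⟩ : {z : (σ₀ → ℂ) × (σ₁ → ℂ) //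
        Φ z.1 = t ∘ Sum.inl ∧ Ψ z.1 z.2 = t ∘ Sum.inr})) (by
          intro y y' hy
          simpa [Subtype.ext_iff] using hy)
    rw [ht2] at h2
    have h3 : g + 1 ≤ g := by exact_mod_cast h1.trans h2
    omega
  obtain ⟨c, hc, hc'⟩ : ∃ c, L c ∧ ¬ L (c + 1) := by
    by_contra! hcon
    exact hLg (Nat.rec hL0 (fun n ih => hcon n ih) (g + 1))
  have hcount : Generic fun t : τ₀ ⊕ τ₁ → ℂ =>
      ∀ x, Φ x = t ∘ Sum.inl → ENat.card {y // Ψ x y = t ∘ Sum.inr} = c := by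
    -- The dichotomy upgrades the failure of `L (c + 1)` to a generic upper bound.
    have := hc.and ((generic_le_enatCard_or_not (c + 1) hΨ).resolve_left hc')
    refine (Generic.forall_fibre_sum hcard hΦ hdom this).mono fun t ht x hx => ?_
    have h1 := ht x hx
    simp only [Sum.elim_comp_inl, Sum.elim_comp_inr, not_le] at h1
    exact le_antisymm (ENat.lt_natCast_add_one_iff.mp (by exact_mod_cast h1.2)) h1.1
  refine ⟨c, ?_, hcount⟩
  obtain ⟨t, ⟨ht1, ht2⟩, ht3⟩ :=
    ((hcount.and hg).and (hh.comp_injective Sum.inl_injective)).exists_point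
  have := enatCard_triangular (p := fun x => Φ x = t ∘ Sum.inl)
    (q := fun x y => Ψ x y = t ∘ Sum.inr) ht1
  rw [ht2, ht3] at this
  exact_mod_cast this

/-- The number of solutions of two extensions of a common system, combined. -/
theorem exists_generic_glued_count [Fintype σ₂] [Fintype τ₂]
    {Ψ' : (σ₀ → ℂ) → (σ₂ → ℂ) → τ₂ → ℂ} (hcard : Fintype.card τ₀ = Fintype.card σ₀)
    (hΦ : ∀ j, IsPolyFun fun x => Φ x j)
    (hΨ : ∀ j, IsPolyFun fun z : σ₀ ⊕ σ₁ → ℂ => Ψ (z ∘ Sum.inl) (z ∘ Sum.inr) j)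
    (hΨ' : ∀ j, IsPolyFun fun z : σ₀ ⊕ σ₂ → ℂ => Ψ' (z ∘ Sum.inl) (z ∘ Sum.inr) j)
    {h g g' : ℕ} (h0 : h ≠ 0) (hh : Generic fun t => ENat.card {x // Φ x = t} = h)
    (hg : Generic fun t : τ₀ ⊕ τ₁ → ℂ => ENat.card {z : (σ₀ → ℂ) × (σ₁ → ℂ) //
      Φ z.1 = t ∘ Sum.inl ∧ Ψ z.1 z.2 = t ∘ Sum.inr} = g)
    (hg' : Generic fun t : τ₀ ⊕ τ₂ → ℂ => ENat.card {z : (σ₀ → ℂ) × (σ₂ → ℂ) //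
      Φ z.1 = t ∘ Sum.inl ∧ Ψ' z.1 z.2 = t ∘ Sum.inr} = g') :
    ∃ N : ℕ, h * N = g * g' ∧ Generic fun t : τ₀ ⊕ (τ₁ ⊕ τ₂) → ℂ =>
      ENat.card {z : (σ₀ → ℂ) × ((σ₁ → ℂ) × (σ₂ → ℂ)) // Φ z.1 = t ∘ Sum.inl ∧
        (Ψ z.1 z.2.1 = t ∘ Sum.inr ∘ Sum.inl ∧ Ψ' z.1 z.2.2 = t ∘ Sum.inr ∘ Sum.inr)} = N := by
  obtain ⟨c, rfl, hc⟩ := exists_generic_extension_count hcard hΦ hΨ h0 hh hg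
  obtain ⟨c', rfl, hc'⟩ := exists_generic_extension_count hcard hΦ hΨ' h0 hh hg'
  refine ⟨h * (c * c'), by ring, ?_⟩
  have inj : Function.Injective (Sum.map id Sum.inl : τ₀ ⊕ τ₁ → τ₀ ⊕ (τ₁ ⊕ τ₂)) :=
    Function.injective_id.sumMap Sum.inl_injective
  have inj' : Function.Injective (Sum.map id Sum.inr : τ₀ ⊕ τ₂ → τ₀ ⊕ (τ₁ ⊕ τ₂)) :=
    Function.injective_id.sumMap Sum.inr_injective
  refine (((hc.comp_injective inj).and (hc'.comp_injective inj')).and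
    (hh.comp_injective Sum.inl_injective)).mono ?_
  rintro t ⟨⟨h1, h2⟩, h3⟩
  refine (enatCard_triangular (p := fun x => Φ x = t ∘ Sum.inl) (q := fun x (y : (σ₁ → ℂ) × (σ₂ → ℂ)) =>
    Ψ x y.1 = t ∘ Sum.inr ∘ Sum.inl ∧ Ψ' x y.2 = t ∘ Sum.inr ∘ Sum.inr) (c := c * c')
    fun x hx => ?_).trans (by rw [h3, ← Nat.cast_mul])
  have := ENat.card_congr (Equiv.subtypeProdEquivProd
    (p := fun y => Ψ x y = t ∘ Sum.inr ∘ Sum.inl) (q := fun y => Ψ' x y = t ∘ Sum.inr ∘ Sum.inr))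
  rw [this, ENat.card_prod, Nat.cast_mul]
  exact congrArg₂ _ (h1 x hx) (h2 x hx)

end Extension

/-! ### Rigid motions and anchored realizations -/

/-- The squared length of the segment that a realization assigns to an unordered pair. -/
def sqLen {V : Type*} (ρ : Realization V) : Sym2 V → ℂ :=
  Sym2.lift ⟨fun u v => (ρ u - ρ v) ⬝ᵥ (ρ u - ρ v), fun u v => by
    dsimp only
    rw [← neg_sub (ρ v), neg_dotProduct_neg]⟩

theorem sqLen_mk {V : Type*} (ρ : Realization V) (u v : V) :
    sqLen ρ s(u, v) = (ρ u - ρ v) ⬝ᵥ (ρ u - ρ v) := rfl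

theorem sqLen_comp {V W : Type*} (ρ : Realization V) (f : W → V) (e : Sym2 W) :
    sqLen (ρ ∘ f) e = sqLen ρ (e.map f) := by
  induction e with | _ a b => rfl

theorem compatible_iff {V : Type*} {G : SimpleGraph V} {l : G.edgeSet → ℂ} {ρ : Realization V} :
    Compatible G l ρ ↔ ∀ e : G.edgeSet, sqLen ρ e = l e := by
  constructor
  · rintro h ⟨e, he⟩
    induction e with | _ a b => exact h a b he
  · intro h u v huv
    exact h ⟨s(u, v), huv⟩

/-- The position of `u`, and the isotropic coordinate of the vector from `u` to `v`. Prescribing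
these values selects one representative of each equivalence class of realizations. -/
def anchor {V : Type*} (u v : V) (ρ : Realization V) : Fin 3 → ℂ :=
  ![ρ u 0, ρ u 1, (ρ v 0 - ρ u 0) + Complex.I * (ρ v 1 - ρ u 1)]

theorem anchor_eq_iff {V : Type*} {u v : V} {ρ : Realization V} {s : Fin 3 → ℂ} :
    anchor u v ρ = s ↔ ρ u 0 = s 0 ∧ ρ u 1 = s 1 ∧
      (ρ v 0 - ρ u 0) + Complex.I * (ρ v 1 - ρ u 1) = s 2 := by
  rw [funext_iff, Fin.forall_fin_succ, Fin.forall_fin_succ, Fin.forall_fin_one]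
  rfl

/-- Over ℂ the form splits into two isotropic factors. Once one factor is a known nonzero number,
the length equation is linear in the other. -/
theorem sqLen_eq_isotropic {V : Type*} (ρ : Realization V) (u v : V) :
    sqLen ρ s(u, v) = ((ρ v 0 - ρ u 0) + Complex.I * (ρ v 1 - ρ u 1)) *
      ((ρ v 0 - ρ u 0) - Complex.I * (ρ v 1 - ρ u 1)) := by
  simp only [sqLen_mk, dotProduct, Fin.sum_univ_two, Pi.sub_apply]
  linear_combination ((ρ v 1 - ρ u 1) ^ 2) * Complex.I_sq

theorem sqLen_eq_of_equivalent {V : Type*} {ρ τ : Realization V} (h : Equivalent ρ τ) (e : Sym2 V) :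
    sqLen τ e = sqLen ρ e := by
  obtain ⟨A, b, hA, -, h⟩ := h
  induction e with | _ x y =>
  have h1 : τ x - τ y = A.mulVec (ρ x - ρ y) := by
    rw [h, h, Matrix.mulVec_sub]
    abel
  rw [sqLen_mk, sqLen_mk, h1, Matrix.dotProduct_mulVec, Matrix.vecMul_mulVec,
    mul_eq_one_comm.mp hA, Matrix.vecMul_one]

/-- The rotation that multiplies the isotropic coordinate `x₁ + i x₂` by `c`. -/
noncomputable def rotation (c : ℂ) : Matrix (Fin 2) (Fin 2) ℂ :=
  !![(c + c⁻¹) / 2, Complex.I * (c - c⁻¹) / 2; -(Complex.I * (c - c⁻¹)) / 2, (c + c⁻¹) / 2]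

theorem rotation_mul_transpose {c : ℂ} (hc : c ≠ 0) :
    rotation c * (rotation c).transpose = 1 := by
  ext i j
  have hI := Complex.I_sq
  fin_cases i <;> fin_cases j <;>
    simp [rotation, Matrix.mul_apply, Fin.sum_univ_two] <;> field_simp <;>
    ring_nf <;> simp [hI] <;> ring

theorem det_rotation {c : ℂ} (hc : c ≠ 0) : (rotation c).det = 1 := by
  have hI := Complex.I_sq
  simp [rotation, Matrix.det_fin_two]
  field_simp
  ring_nf
  simp [hI]
  ring

theorem isotropic_rotation {c : ℂ} (x : Fin 2 → ℂ) :
    (rotation c).mulVec x 0 + Complex.I * (rotation c).mulVec x 1 =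
      c * (x 0 + Complex.I * x 1) := by
  have hI := Complex.I_sq
  simp [rotation, Matrix.mulVec, dotProduct, Fin.sum_univ_two]
  linear_combination (-(c - c⁻¹) / 2 * x 0) * hI

/-- Such an `A` multiplies the isotropic coordinate by `A 0 0 + i * A 1 0`, which must then be 1.
The determinant is the product of this factor and `A 0 0 - i * A 1 0`, so the latter is 1 too. -/
theorem eq_one_of_isotropic_eq {A : Matrix (Fin 2) (Fin 2) ℂ} (hA : A * A.transpose = 1)
    (hd : A.det = 1) {x : Fin 2 → ℂ} (hx : x 0 + Complex.I * x 1 ≠ 0)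
    (h : A.mulVec x 0 + Complex.I * A.mulVec x 1 = x 0 + Complex.I * x 1) : A = 1 := by
  have hadj : A.transpose = A.adjugate := by
    have h1 : A * A.adjugate = 1 := by rw [Matrix.mul_adjugate, hd, one_smul]
    have h2 := mul_eq_one_comm.mp hA
    calc A.transpose = A.transpose * (A * A.adjugate) := by rw [h1, mul_one]
      _ = A.adjugate := by rw [← mul_assoc, h2, one_mul]
  have e1 : A 0 0 = A 1 1 := by
    have := congrFun (congrFun hadj 0) 0
    simpa [Matrix.adjugate_fin_two] using this
  have e2 : A 0 1 = -A 1 0 := by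
    have := congrFun (congrFun hadj 1) 0
    simpa [Matrix.adjugate_fin_two] using this
  rw [Matrix.det_fin_two, ← e1, e2] at hd
  simp only [Matrix.mulVec, dotProduct, Fin.sum_univ_two, ← e1, e2] at h
  have hI := Complex.I_sq
  have h3 : A 0 0 + Complex.I * A 1 0 = 1 := by
    apply mul_right_cancel₀ hx
    linear_combination h + (A 1 0 * x 1) * hI
  have h4 : A 0 0 - Complex.I * A 1 0 = 1 := by
    linear_combination hd - (A 0 0 - Complex.I * A 1 0) * h3 - (A 1 0) ^ 2 * hI
  have h5 : A 0 0 = 1 := by linear_combination (h3 + h4) / 2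
  have h6 : A 1 0 = 0 := by
    have : Complex.I * A 1 0 = 0 := by linear_combination (h3 - h4) / 2
    simpa using this
  ext i j
  fin_cases i <;> fin_cases j <;> simp [h5, h6, e2, ← e1]

/-- Equivalence classes of realizations correspond to realizations with prescribed anchor. -/
theorem numRealizations_eq {V : Type*} {G : SimpleGraph V} {u v : V} (h : G.Adj u v)
    {l : G.edgeSet → ℂ} (hl : l ⟨s(u, v), h⟩ ≠ 0) {s : Fin 3 → ℂ} (hs : s 2 ≠ 0) :
    numRealizations G l =
      ENat.card {ρ : Realization V // (∀ e : G.edgeSet, sqLen ρ e = l e) ∧ anchor u v ρ = s} := by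
  symm
  let f : {ρ : Realization V // (∀ e : G.edgeSet, sqLen ρ e = l e) ∧ anchor u v ρ = s} →
      Quotient (realizationSetoid G l) := fun ρ =>
    Quotient.mk _ ⟨ρ.1, compatible_iff.mpr ρ.2.1⟩
  refine ENat.card_congr (Equiv.ofBijective f ⟨?_, ?_⟩)
  · rintro ⟨ρ, hρ, hρs⟩ ⟨τ, hτ, hτs⟩ hf
    obtain ⟨A, b, hA, hd, hAb⟩ : Equivalent ρ τ := Quotient.exact hf
    rw [anchor_eq_iff] at hρs hτs
    have h1 : τ v - τ u = A.mulVec (ρ v - ρ u) := by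
      rw [hAb, hAb, Matrix.mulVec_sub]
      abel
    have hA1 : A = 1 := by
      refine eq_one_of_isotropic_eq hA hd (x := ρ v - ρ u) ?_ ?_
      · simp only [Pi.sub_apply]
        rwa [hρs.2.2]
      · rw [← h1]
        simp only [Pi.sub_apply]
        rw [hρs.2.2, hτs.2.2]
    have hb : b = 0 := by
      have h2 := hAb u
      rw [hA1, Matrix.one_mulVec] at h2
      have h3 : τ u = ρ u := by
        funext i
        fin_cases i
        · exact hτs.1.trans hρs.1.symm
        · exact hτs.2.1.trans hρs.2.1.symm
      rw [h3] at h2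
      simpa using h2
    refine Subtype.ext (funext fun w => ?_)
    simp [hAb w, hA1, hb]
  · intro q
    induction q using Quotient.inductionOn with | _ ρ =>
    obtain ⟨ρ, hρ⟩ := ρ
    rw [compatible_iff] at hρ
    have hx : (ρ v 0 - ρ u 0) + Complex.I * (ρ v 1 - ρ u 1) ≠ 0 := by
      have := hρ ⟨s(u, v), h⟩
      rw [sqLen_eq_isotropic] at this
      exact left_ne_zero_of_mul (this ▸ hl)
    set x := (ρ v 0 - ρ u 0) + Complex.I * (ρ v 1 - ρ u 1) with hxdef
    have hc : s 2 / x ≠ 0 := div_ne_zero hs hx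
    -- The rotation rescales the isotropic coordinate of the edge from `x` to `s 2`, and the
    -- translation puts `u` at its prescribed position.
    let τ : Realization V := fun w => (rotation (s 2 / x)).mulVec (ρ w) +
      (![s 0, s 1] - (rotation (s 2 / x)).mulVec (ρ u))
    have heq : Equivalent ρ τ :=
      ⟨_, _, rotation_mul_transpose hc, det_rotation hc, fun w => rfl⟩
    refine ⟨⟨τ, fun e => (sqLen_eq_of_equivalent heq e).trans (hρ e), ?_⟩,
      Quotient.sound ((Equivalent.equivalence V).symm heq)⟩
    have hτu : τ u = ![s 0, s 1] := by simp [τ]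
    have hτ : τ v - τ u = (rotation (s 2 / x)).mulVec (ρ v - ρ u) := by
      simp only [τ, Matrix.mulVec_sub]
      abel
    rw [anchor_eq_iff]
    refine ⟨by simp [hτu], by simp [hτu], ?_⟩
    have h1 := isotropic_rotation (c := s 2 / x) (ρ v - ρ u)
    rw [← hτ] at h1
    simp only [Pi.sub_apply] at h1
    rw [h1, ← hxdef, div_mul_cancel₀ _ hx]

/-- The generic number of realizations up to equivalence is the generic number of realizations
with prescribed anchor. -/
theorem isGenericCount_iff {V τ : Type*} {G : SimpleGraph V} {u v : V} (h : G.Adj u v) {N : ℕ}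
    {ε : τ → Sym2 V} (hε : Function.Injective ε) (hr : Set.range ε = G.edgeSet) :
    IsGenericCount G N ↔ Generic fun t : τ ⊕ Fin 3 → ℂ =>
      ENat.card {ρ : Realization V //
        (∀ e, sqLen ρ (ε e) = t (Sum.inl e)) ∧ anchor u v ρ = t ∘ Sum.inr} = N := by
  let φ : τ ≃ G.edgeSet := (Equiv.ofInjective ε hε).trans (Equiv.setCongr hr)
  have hφ (e) : (φ e : Sym2 V) = ε e := rfl
  have key (l : G.edgeSet → ℂ) (s : Fin 3 → ℂ) (hl : l ⟨s(u, v), h⟩ ≠ 0) (hs : s 2 ≠ 0) :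
      numRealizations G l = ENat.card {ρ : Realization V //
        (∀ e, sqLen ρ (ε e) = l (φ e)) ∧ anchor u v ρ = s} := by
    rw [numRealizations_eq h hl hs]
    simp only [← hφ, φ.forall_congr_left, Equiv.apply_symm_apply]
  change (Generic fun l => numRealizations G l = N) ↔ _
  constructor
  · intro hG
    have h1 := (hG.comp_injective (f := fun e => (Sum.inl (φ.symm e) : τ ⊕ Fin 3))
      (Sum.inl_injective.comp φ.symm.injective)).and
      ((Generic.apply_ne_zero (Sum.inl (φ.symm ⟨s(u, v), h⟩) : τ ⊕ Fin 3)).and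
        (Generic.apply_ne_zero (Sum.inr 2)))
    refine h1.mono fun t ht => ?_
    rw [← ht.1, key _ (t ∘ Sum.inr) ht.2.1 ht.2.2]
    simp
  · intro hG
    -- One suitable anchor suffices, because the number of equivalence classes does not depend on
    -- it.
    obtain ⟨s, hs, hs2⟩ := (hG.exists_section.and (Generic.apply_ne_zero 2)).exists_point
    refine ((hs.comp_injective φ.injective).and
      (Generic.apply_ne_zero (⟨s(u, v), h⟩ : G.edgeSet))).mono fun l hl => ?_
    rw [key l s hl.2 hs2, ← hl.1]
    rfl

theorem IsGenericCount.of_iso {V V' : Type*} {G : SimpleGraph V} {G' : SimpleGraph V'}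
    (f : G ≃g G') {u v : V} (h : G.Adj u v) {N : ℕ} (hG : IsGenericCount G N) :
    IsGenericCount G' N := by
  have hr : Set.range (fun e : G.edgeSet => (e : Sym2 V).map f) = G'.edgeSet := by
    ext e
    constructor
    · rintro ⟨e, rfl⟩
      exact (f.mapEdgeSet e).2
    · intro he
      exact ⟨f.mapEdgeSet.symm ⟨e, he⟩,
        congrArg Subtype.val (f.mapEdgeSet.apply_symm_apply ⟨e, he⟩)⟩
  rw [isGenericCount_iff h Subtype.val_injective Subtype.range_val] at hG
  rw [isGenericCount_iff (f.map_adj_iff.mpr h)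
    ((Sym2.map.injective f.injective).comp Subtype.val_injective) hr]
  refine hG.mono fun t ht => ?_
  rw [← ht]
  refine ENat.card_congr (Equiv.subtypeEquiv (Equiv.arrowCongr f.symm.toEquiv (Equiv.refl _)) ?_)
  intro ρ
  have : Equiv.arrowCongr f.symm.toEquiv (Equiv.refl _) ρ = ρ ∘ f := rfl
  rw [this]
  simp only [sqLen_comp]
  rfl

/-! ### Sparsity counts of Laman graphs -/

theorem isLaman_iff {V : Type*} [Finite V] {G : SimpleGraph V} :
    IsLaman G ↔ G.edgeSet.ncard + 3 = 2 * Nat.card V ∧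
      ∀ (S : Set V) (E : Set (Sym2 V)), E ⊆ G.edgeSet → (∀ e ∈ E, ∀ x ∈ e, x ∈ S) →
        2 ≤ S.ncard → E.ncard + 3 ≤ 2 * S.ncard := by
  refine and_congr_right fun _ => ⟨fun h S E hE hS hc => ?_, fun h G' hG' => ?_⟩
  · let G' : G.Subgraph :=
      { verts := S
        Adj a b := s(a, b) ∈ E
        adj_sub hab := hE hab
        edge_vert hab := hS _ hab _ (Sym2.mem_mk_left _ _)
        symm := ⟨fun a b hab => by rwa [Sym2.eq_swap]⟩ }
    have hG' : G'.edgeSet = E := by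
      ext e
      induction e with | _ a b => rfl
    have := h G' hc
    rwa [hG'] at this
  · exact h _ _ G'.edgeSet_subset (fun e he x hx => G'.mem_verts_of_mem_edge he hx) hG'

theorem IsLaman.two_le_card {V : Type*} {G : SimpleGraph V} (hG : IsLaman G) : 2 ≤ Nat.card V := by
  have := hG.1
  omega

theorem IsLaman.exists_adj {V : Type*} {G : SimpleGraph V} (hG : IsLaman G) : ∃ u v, G.Adj u v := by
  have h : G.edgeSet.ncard ≠ 0 := by
    have := hG.1
    omega
  obtain ⟨e, he⟩ := Set.nonempty_of_ncard_ne_zero h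
  induction e with | _ a b => exact ⟨a, b, he⟩

/-- Below two vertices the sparsity bound fails, but no edge fits there; both cases are needed when
a vertex set is cut into pieces. -/
theorem IsLaman.ncard_add_three_le_or {V : Type*} [Finite V] {G : SimpleGraph V} (hG : IsLaman G)
    {S : Set V} {E : Set (Sym2 V)} (hE : E ⊆ G.edgeSet) (hS : ∀ e ∈ E, ∀ x ∈ e, x ∈ S) :
    E.ncard + 3 ≤ 2 * S.ncard ∨ (S.ncard ≤ 1 ∧ E.ncard = 0) := by
  by_cases hc : 2 ≤ S.ncard
  · exact Or.inl ((isLaman_iff.mp hG).2 S E hE hS hc)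
  refine Or.inr ⟨by omega, ?_⟩
  rw [Set.ncard_eq_zero, Set.eq_empty_iff_forall_notMem]
  intro e he
  induction e with | _ a b =>
  refine (hE he : G.Adj a b).ne ((Set.ncard_le_one_iff).mp (by omega : S.ncard ≤ 1)
    (hS _ he _ (Sym2.mem_mk_left _ _)) (hS _ he _ (Sym2.mem_mk_right _ _)))

theorem IsLaman.of_iso {V V' : Type*} [Finite V] {G : SimpleGraph V} {G' : SimpleGraph V'}
    (f : G ≃g G') (hG : IsLaman G) : IsLaman G' := by
  have : Finite V' := Finite.of_equiv V f.toEquiv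
  rw [isLaman_iff] at hG ⊢
  refine ⟨?_, fun S E hE hS hc => ?_⟩
  · rw [← Nat.card_congr f.toEquiv, ← hG.1]
    congr 1
    exact Nat.card_congr f.mapEdgeSet.symm
  · have h := hG.2 (f.symm '' S) (Sym2.map f.symm '' E) ?_ ?_ ?_
    · rwa [Set.ncard_image_of_injective _ (Sym2.map.injective f.symm.injective),
        Set.ncard_image_of_injective _ f.symm.injective] at h
    · rintro _ ⟨e, he, rfl⟩
      exact (f.symm.mapEdgeSet ⟨e, hE he⟩).2
    · rintro _ ⟨e, he, rfl⟩ x hx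
      obtain ⟨y, hy, rfl⟩ := Sym2.mem_map.mp hx
      exact ⟨y, hS e he y hy, rfl⟩
    · rwa [Set.ncard_image_of_injective _ f.symm.injective]

/-- A Laman subgraph of a Laman graph is induced. -/
theorem IsLaman.adj_of_adj_map {W V : Type*} [Finite W] [Finite V] {H : SimpleGraph W}
    {G : SimpleGraph V} (hH : IsLaman H) (hG : IsLaman G) (f : H →g G) (hf : Function.Injective f)
    {a b : W} (hab : G.Adj (f a) (f b)) : H.Adj a b := by
  by_contra hn
  have hinj := Sym2.map.injective hf
  have hnot : s(f a, f b) ∉ Sym2.map f '' H.edgeSet := by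
    rintro ⟨e, he, heq⟩
    rw [← Sym2.map_mk, hinj.eq_iff] at heq
    rw [heq] at he
    exact hn he
  -- `H` is already tight, so one more edge on its image would violate sparsity of `G`.
  have h := (isLaman_iff.mp hG).2 (Set.range f) (insert s(f a, f b) (Sym2.map f '' H.edgeSet))
    ?_ ?_ ?_
  · rw [Set.ncard_insert_of_notMem hnot, Set.ncard_image_of_injective _ hinj,
      ← Set.image_univ, Set.ncard_image_of_injective _ hf, Set.ncard_univ] at h
    have := hH.1
    omega
  · rintro e (rfl | ⟨e, he, rfl⟩)
    · exact hab
    · exact (f.mapEdgeSet ⟨e, he⟩).2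
  · rintro e (rfl | ⟨e, he, rfl⟩) x hx
    · rcases Sym2.mem_iff.mp hx with rfl | rfl <;> exact ⟨_, rfl⟩
    · obtain ⟨y, -, rfl⟩ := Sym2.mem_map.mp hx
      exact ⟨y, rfl⟩
  · rw [← Set.image_univ, Set.ncard_image_of_injective _ hf, Set.ncard_univ]
    exact hH.two_le_card

/-! ### Gluing graphs along a common subgraph -/

section Glue

variable {W A B : Type*}

/-- The edges of a graph on `W ⊕ A` with an endpoint in `A`. -/
def outerEdges (K : SimpleGraph (W ⊕ A)) : Set (Sym2 (W ⊕ A)) :=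
  {e ∈ K.edgeSet | ∃ a, Sum.inr a ∈ e}

/-- The inclusion of the first part into a vertex set glued from two parts. -/
def leftIncl : W ⊕ A → W ⊕ (A ⊕ B) := Sum.map id Sum.inl

/-- The inclusion of the second part into a vertex set glued from two parts. -/
def rightIncl : W ⊕ B → W ⊕ (A ⊕ B) := Sum.map id Sum.inr

theorem leftIncl_injective : Function.Injective (leftIncl : W ⊕ A → W ⊕ (A ⊕ B)) :=
  Function.injective_id.sumMap Sum.inl_injective

theorem rightIncl_injective : Function.Injective (rightIncl : W ⊕ B → W ⊕ (A ⊕ B)) :=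
  Function.injective_id.sumMap Sum.inr_injective

/-- The edges of a graph on `W ⊕ A`, split into those inside `W` and the others. -/
def splitEdge (H : SimpleGraph W) (K : SimpleGraph (W ⊕ A)) :
    H.edgeSet ⊕ outerEdges K → Sym2 (W ⊕ A) :=
  Sum.elim (fun e => (e : Sym2 W).map Sum.inl) (fun e => e)

/-- The edges of a graph glued from two parts. -/
def gluedEdge (H : SimpleGraph W) (K₁ : SimpleGraph (W ⊕ A)) (K₂ : SimpleGraph (W ⊕ B)) :
    H.edgeSet ⊕ (outerEdges K₁ ⊕ outerEdges K₂) → Sym2 (W ⊕ (A ⊕ B)) :=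
  Sum.elim (fun e => (e : Sym2 W).map Sum.inl)
    (Sum.elim (fun e => (e : Sym2 (W ⊕ A)).map leftIncl)
      (fun e => (e : Sym2 (W ⊕ B)).map rightIncl))

/-- The graph glued from two graphs along the common vertex set `W`. -/
def glue (H : SimpleGraph W) (K₁ : SimpleGraph (W ⊕ A)) (K₂ : SimpleGraph (W ⊕ B)) :
    SimpleGraph (W ⊕ (A ⊕ B)) :=
  SimpleGraph.fromEdgeSet (Set.range (gluedEdge H K₁ K₂))

variable {H : SimpleGraph W} {K₁ : SimpleGraph (W ⊕ A)} {K₂ : SimpleGraph (W ⊕ B)}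

theorem splitEdge_injective : Function.Injective (splitEdge H K₁) := by
  refine Function.Injective.sumElim
    ((Sym2.map.injective Sum.inl_injective).comp Subtype.val_injective) Subtype.val_injective ?_
  rintro e ⟨d, _, a, ha⟩ h
  dsimp only at h
  rw [← h, Sym2.mem_map] at ha
  simp at ha

theorem range_splitEdge (h : K₁.comap Sum.inl = H) : Set.range (splitEdge H K₁) = K₁.edgeSet := by
  subst h
  ext e
  constructor
  · rintro ⟨⟨e, he⟩ | ⟨e, he⟩, rfl⟩
    · induction e with | _ a b => exact he
    · exact he.1
  · intro he
    by_cases h : ∃ a, Sum.inr a ∈ e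
    · exact ⟨Sum.inr ⟨e, he, h⟩, rfl⟩
    · induction e with | _ x y =>
      rcases x with x | x
      · rcases y with y | y
        · exact ⟨Sum.inl ⟨s(x, y), he⟩, rfl⟩
        · exact absurd ⟨y, Sym2.mem_mk_right _ _⟩ h
      · exact absurd ⟨x, Sym2.mem_mk_left _ _⟩ h

theorem gluedEdge_injective : Function.Injective (gluedEdge H K₁ K₂) := by
  refine Function.Injective.sumElim
    ((Sym2.map.injective Sum.inl_injective).comp Subtype.val_injective)
    (Function.Injective.sumElim
      ((Sym2.map.injective leftIncl_injective).comp Subtype.val_injective)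
      ((Sym2.map.injective rightIncl_injective).comp Subtype.val_injective) ?_) ?_
  · rintro ⟨d, _, a, ha⟩ ⟨e, he⟩ h
    have h1 : leftIncl (Sum.inr a) ∈ d.map (leftIncl : W ⊕ A → W ⊕ (A ⊕ B)) :=
      Sym2.mem_map.mpr ⟨_, ha, rfl⟩
    dsimp only at h
    rw [h, Sym2.mem_map] at h1
    obtain ⟨x, -, hx⟩ := h1
    rcases x with x | x <;> simp [leftIncl, rightIncl] at hx
  · rintro e (⟨d, _, a, ha⟩ | ⟨d, _, a, ha⟩) h
    · have h1 : leftIncl (Sum.inr a) ∈ d.map (leftIncl : W ⊕ A → W ⊕ (A ⊕ B)) :=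
        Sym2.mem_map.mpr ⟨_, ha, rfl⟩
      simp only [Sum.elim_inl] at h
      rw [← h, Sym2.mem_map] at h1
      simp [leftIncl] at h1
    · have h1 : rightIncl (Sum.inr a) ∈ d.map (rightIncl : W ⊕ B → W ⊕ (A ⊕ B)) :=
        Sym2.mem_map.mpr ⟨_, ha, rfl⟩
      simp only [Sum.elim_inr] at h
      rw [← h, Sym2.mem_map] at h1
      simp [rightIncl] at h1

theorem not_isDiag_map {V V' : Type*} {G : SimpleGraph V} {f : V → V'} (hf : Function.Injective f)
    {e : Sym2 V} (he : e ∈ G.edgeSet) : ¬ (e.map f).IsDiag := by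
  rw [Sym2.isDiag_map hf]
  exact G.not_isDiag_of_mem_edgeSet he

theorem range_gluedEdge : Set.range (gluedEdge H K₁ K₂) = (glue H K₁ K₂).edgeSet := by
  rw [glue, SimpleGraph.edgeSet_fromEdgeSet, eq_comm, sdiff_eq_left, Set.disjoint_left]
  rintro _ ⟨⟨e, he⟩ | ⟨e, he⟩ | ⟨e, he⟩, rfl⟩
  · exact not_isDiag_map Sum.inl_injective he
  · exact not_isDiag_map leftIncl_injective he.1
  · exact not_isDiag_map rightIncl_injective he.1

theorem glue_adj_inl {a b : W} (h : H.Adj a b) : (glue H K₁ K₂).Adj (Sum.inl a) (Sum.inl b) := by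
  rw [← SimpleGraph.mem_edgeSet, ← range_gluedEdge]
  exact ⟨Sum.inl ⟨s(a, b), h⟩, rfl⟩

theorem ncard_sum {α β : Type*} [Finite α] [Finite β] (S : Set (α ⊕ β)) :
    S.ncard = (Sum.inl ⁻¹' S).ncard + (Sum.inr ⁻¹' S).ncard := by
  conv_lhs => rw [← Set.image_preimage_inl_union_image_preimage_inr S]
  rw [Set.ncard_union_eq, Set.ncard_image_of_injective _ Sum.inl_injective,
    Set.ncard_image_of_injective _ Sum.inr_injective]
  rw [Set.disjoint_left]
  rintro _ ⟨a, -, rfl⟩ ⟨b, -, h⟩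
  cases h

variable [Finite W] [Finite A] [Finite B]

theorem ncard_edgeSet_eq_add (h : K₁.comap Sum.inl = H) :
    K₁.edgeSet.ncard = H.edgeSet.ncard + (outerEdges K₁).ncard := by
  rw [← range_splitEdge h, ← Set.image_univ,
    Set.ncard_image_of_injective _ splitEdge_injective, Set.ncard_univ, Nat.card_sum]
  rfl

/-- Sparsity of `K₁` is applied to all of `W` together with `S`: the edges of `H` use up exactly
2|W| - 3, leaving at most 2|S| for `E`. -/
theorem ncard_outerEdges_le (hH : IsLaman H) (hK : IsLaman K₁) (h : K₁.comap Sum.inl = H)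
    {S : Set A} {E : Set (Sym2 (W ⊕ A))} (hE : E ⊆ outerEdges K₁)
    (hS : ∀ e ∈ E, ∀ a, Sum.inr a ∈ e → a ∈ S) : E.ncard ≤ 2 * S.ncard := by
  have hdisj : Disjoint (Sym2.map (Sum.inl : W → W ⊕ A) '' H.edgeSet) E := by
    rw [Set.disjoint_left]
    rintro _ ⟨e, he, rfl⟩ he'
    obtain ⟨a, ha⟩ := (hE he').2
    rw [Sym2.mem_map] at ha
    simp at ha
  have hcard : (Set.range (Sum.inl : W → W ⊕ A) ∪ Sum.inr '' S).ncard = Nat.card W + S.ncard := by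
    rw [ncard_sum, ← Set.ncard_univ]
    congr 2 <;> ext <;> simp
  have := (isLaman_iff.mp hK).2 (Set.range Sum.inl ∪ Sum.inr '' S)
    (Sym2.map Sum.inl '' H.edgeSet ∪ E) ?_ ?_ ?_
  · rw [Set.ncard_union_eq hdisj, hcard,
      Set.ncard_image_of_injective _ (Sym2.map.injective Sum.inl_injective)] at this
    have := hH.1
    omega
  · rw [← range_splitEdge h]
    refine Set.union_subset ?_ fun e he => ⟨Sum.inr ⟨e, hE he⟩, rfl⟩
    rintro _ ⟨e, he, rfl⟩
    exact ⟨Sum.inl ⟨e, he⟩, rfl⟩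
  · rintro e (⟨e, he, rfl⟩ | he) (x | x) hx
    · simp
    · rw [Sym2.mem_map] at hx
      simp at hx
    · simp
    · exact Or.inr ⟨x, hS e he x hx, rfl⟩
  · rw [hcard]
    exact hH.two_le_card.trans (Nat.le_add_right _ _)

/-- Gluing two Laman graphs along a common Laman subgraph gives a Laman graph. -/
theorem isLaman_glue (hH : IsLaman H) (hK₁ : IsLaman K₁) (hK₂ : IsLaman K₂)
    (h₁ : K₁.comap Sum.inl = H) (h₂ : K₂.comap Sum.inl = H) : IsLaman (glue H K₁ K₂) := by
  rw [isLaman_iff]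
  constructor
  · rw [← range_gluedEdge, ← Set.image_univ,
      Set.ncard_image_of_injective _ gluedEdge_injective, Set.ncard_univ, Nat.card_sum,
      Nat.card_sum, Nat.card_sum, Nat.card_sum]
    have e0 := hH.1
    have e1 := hK₁.1
    have e2 := hK₂.1
    rw [ncard_edgeSet_eq_add h₁, Nat.card_sum] at e1
    rw [ncard_edgeSet_eq_add h₂, Nat.card_sum] at e2
    simp only [Nat.card_coe_set_eq]
    omega
  · intro S E hE hS hc
    let E₀ : Set (Sym2 W) := {e ∈ H.edgeSet | e.map Sum.inl ∈ E}
    let E₁ : Set (Sym2 (W ⊕ A)) := {e ∈ outerEdges K₁ | e.map leftIncl ∈ E}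
    let E₂ : Set (Sym2 (W ⊕ B)) := {e ∈ outerEdges K₂ | e.map rightIncl ∈ E}
    have hsub : E ⊆ Sym2.map Sum.inl '' E₀ ∪
        (Sym2.map leftIncl '' E₁ ∪ Sym2.map rightIncl '' E₂) := by
      intro e he
      have := hE he
      rw [← range_gluedEdge] at this
      obtain ⟨⟨e, h⟩ | ⟨e, h⟩ | ⟨e, h⟩, rfl⟩ := this
      · exact Or.inl ⟨e, ⟨h, he⟩, rfl⟩
      · exact Or.inr (Or.inl ⟨e, ⟨h, he⟩, rfl⟩)
      · exact Or.inr (Or.inr ⟨e, ⟨h, he⟩, rfl⟩)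
    have hcard : E.ncard ≤ E₀.ncard + (E₁.ncard + E₂.ncard) := by
      refine (Set.ncard_le_ncard hsub).trans ((Set.ncard_union_le _ _).trans ?_)
      refine add_le_add (Set.ncard_image_le) ((Set.ncard_union_le _ _).trans ?_)
      exact add_le_add Set.ncard_image_le Set.ncard_image_le
    let S₁ : Set (W ⊕ A) := leftIncl ⁻¹' S
    let S₂ : Set (W ⊕ B) := rightIncl ⁻¹' S
    have c := ncard_sum S
    have c' := ncard_sum (Sum.inr ⁻¹' S)
    have c₁ : S₁.ncard = (Sum.inl ⁻¹' S).ncard + (Sum.inl ⁻¹' (Sum.inr ⁻¹' S)).ncard := ncard_sum S₁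
    have c₂ : S₂.ncard = (Sum.inl ⁻¹' S).ncard + (Sum.inr ⁻¹' (Sum.inr ⁻¹' S)).ncard := ncard_sum S₂
    have hS₁ : ∀ e ∈ E₁, ∀ x ∈ e, x ∈ S₁ := fun e he x hx =>
      hS _ he.2 _ (Sym2.mem_map.mpr ⟨x, hx, rfl⟩)
    have hS₂ : ∀ e ∈ E₂, ∀ x ∈ e, x ∈ S₂ := fun e he x hx =>
      hS _ he.2 _ (Sym2.mem_map.mpr ⟨x, hx, rfl⟩)
    have b₀ := hH.ncard_add_three_le_or (S := Sum.inl ⁻¹' S) (E := E₀) (fun e he => he.1)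
      fun e he x hx => hS _ he.2 _ (Sym2.mem_map.mpr ⟨x, hx, rfl⟩)
    have b₁ := hK₁.ncard_add_three_le_or (fun e he => he.1.1) hS₁
    have b₂ := hK₂.ncard_add_three_le_or (fun e he => he.1.1) hS₂
    have d₁ := ncard_outerEdges_le hH hK₁ h₁ (S := Sum.inl ⁻¹' (Sum.inr ⁻¹' S)) (E := E₁)
      (fun e he => he.1) fun e he a ha => hS₁ e he _ ha
    have d₂ := ncard_outerEdges_le hH hK₂ h₂ (S := Sum.inr ⁻¹' (Sum.inr ⁻¹' S)) (E := E₂)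
      (fun e he => he.1) fun e he a ha => hS₂ e he _ ha
    -- If `S` meets `W` in at least two vertices, add `b₀`, `d₁` and `d₂`. Otherwise `E₀` is empty,
    -- and `b₁` and `b₂` suffice because the overlap has at most one vertex.
    omega

end Glue

/-! ### The glued graph as a polynomial system -/

theorem isPolyFun_sqLen {ι V : Type*} {r : (ι → ℂ) → Realization V}
    (hr : ∀ v i, IsPolyFun fun x => r x v i) (e : Sym2 V) : IsPolyFun fun x => sqLen (r x) e := by
  induction e with | _ a b =>
  have h (i) : IsPolyFun fun x => r x a i - r x b i := (hr a i).sub (hr b i)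
  exact IsPolyFun.sum Finset.univ fun i => (h i).mul (h i)

theorem isPolyFun_anchor {ι V : Type*} {r : (ι → ℂ) → Realization V}
    (hr : ∀ v i, IsPolyFun fun x => r x v i) (u v : V) (j : Fin 3) :
    IsPolyFun fun x => anchor u v (r x) j := by
  fin_cases j
  · exact hr u 0
  · exact hr u 1
  · exact ((hr v 0).sub (hr u 0)).add ((IsPolyFun.const _).mul ((hr v 1).sub (hr u 1)))

/-- Exchange of the last two summands. -/
def sumSwapRight (α β γ : Type*) : (α ⊕ β) ⊕ γ → (α ⊕ γ) ⊕ β :=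
  Sum.elim (Sum.map Sum.inl id) (Sum.inl ∘ Sum.inr)

theorem sumSwapRight_injective (α β γ : Type*) : Function.Injective (sumSwapRight α β γ) := by
  refine Function.LeftInverse.injective (g := sumSwapRight α γ β) ?_
  rintro ((a | b) | c) <;> rfl

section Glue

variable {W A B : Type*}

/-- The edge lengths and the anchor of a realization given by its coordinates. -/
noncomputable def baseMap (H : SimpleGraph W) (u v : W) (x : W × Fin 2 → ℂ) :
    H.edgeSet ⊕ Fin 3 → ℂ :=
  Sum.elim (fun e => sqLen (Function.curry x) e) (anchor u v (Function.curry x))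

/-- The lengths of the edges with an endpoint in `A`. -/
noncomputable def outerMap (K : SimpleGraph (W ⊕ A)) (x : W × Fin 2 → ℂ) (y : A × Fin 2 → ℂ) :
    outerEdges K → ℂ :=
  fun e => sqLen (Sum.elim (Function.curry x) (Function.curry y)) e

variable {H : SimpleGraph W} {K₁ : SimpleGraph (W ⊕ A)} {K₂ : SimpleGraph (W ⊕ B)} {u v : W}

theorem baseMap_eq_iff {x : W × Fin 2 → ℂ} {t : H.edgeSet ⊕ Fin 3 → ℂ} :
    baseMap H u v x = t ↔ (∀ e : H.edgeSet, sqLen (Function.curry x) e = t (Sum.inl e)) ∧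
      anchor u v (Function.curry x) = t ∘ Sum.inr := by
  simp [baseMap, funext_iff]

theorem isPolyFun_baseMap (j) : IsPolyFun fun x => baseMap H u v x j := by
  rcases j with j | j
  · exact isPolyFun_sqLen (fun _ _ => .coord _) _
  · exact isPolyFun_anchor (fun _ _ => .coord _) _ _ _

theorem isPolyFun_outerMap (j) : IsPolyFun fun z : (W × Fin 2) ⊕ (A × Fin 2) → ℂ =>
    outerMap K₁ (z ∘ Sum.inl) (z ∘ Sum.inr) j := by
  refine isPolyFun_sqLen ?_ _
  rintro (w | a) i
  · exact .coord (Sum.inl (w, i))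
  · exact .coord (Sum.inr (a, i))

/-- A realization of a disjoint union, given by the coordinates on both parts. -/
def sumRealizationEquiv (W A : Type*) :
    Realization (W ⊕ A) ≃ (W × Fin 2 → ℂ) × (A × Fin 2 → ℂ) :=
  (Equiv.sumArrowEquivProdArrow W A (Fin 2 → ℂ)).trans
    (Equiv.prodCongr (Equiv.curry _ _ _).symm (Equiv.curry _ _ _).symm)

theorem generic_baseMap_of_isGenericCount (huv : H.Adj u v) {h : ℕ} (hH : IsGenericCount H h) :
    Generic fun t => ENat.card {x // baseMap H u v x = t} = h := by
  rw [isGenericCount_iff huv Subtype.val_injective Subtype.range_val] at hH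
  refine hH.mono fun t ht => ?_
  rw [← ht]
  exact ENat.card_congr (Equiv.subtypeEquiv (Equiv.curry _ _ _) fun x => baseMap_eq_iff)

/-- Presents `K₁` as a triangular system: the anchored equations of `H` on `W`, then the outer edge
lengths. The anchor edge lies in `H`, so it can serve both graphs. -/
theorem generic_outerMap_of_isGenericCount (huv : H.Adj u v) (h₁ : K₁.comap Sum.inl = H) {g : ℕ}
    (hK : IsGenericCount K₁ g) : Generic fun t : (H.edgeSet ⊕ Fin 3) ⊕ outerEdges K₁ → ℂ =>
      ENat.card {z : (W × Fin 2 → ℂ) × (A × Fin 2 → ℂ) //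
        baseMap H u v z.1 = t ∘ Sum.inl ∧ outerMap K₁ z.1 z.2 = t ∘ Sum.inr} = g := by
  have huv' : K₁.Adj (Sum.inl u) (Sum.inl v) := by rwa [← h₁] at huv
  rw [isGenericCount_iff huv' splitEdge_injective (range_splitEdge h₁)] at hK
  refine (hK.comp_injective (sumSwapRight_injective _ _ _)).mono fun t ht => ?_
  rw [← ht]
  refine ENat.card_congr (Equiv.subtypeEquiv (sumRealizationEquiv W A).symm fun z => ?_)
  have hz : (sumRealizationEquiv W A).symm z =
      Sum.elim (Function.curry z.1) (Function.curry z.2) := rfl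
  rw [hz, baseMap_eq_iff, Sum.forall]
  simp only [splitEdge, Sum.elim_inl, Sum.elim_inr, ← sqLen_comp, Sum.elim_comp_inl,
    funext_iff (f := outerMap _ _ _)]
  exact and_right_comm

/-- The generic number of realizations of a glued graph. -/
theorem exists_isGenericCount_glue [Finite W] [Finite A] [Finite B] (hH : IsLaman H)
    (h₁ : K₁.comap Sum.inl = H) (h₂ : K₂.comap Sum.inl = H) {h g₁ g₂ : ℕ} (h0 : h ≠ 0)
    (ch : IsGenericCount H h) (c₁ : IsGenericCount K₁ g₁) (c₂ : IsGenericCount K₂ g₂) :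
    ∃ N, h * N = g₁ * g₂ ∧ IsGenericCount (glue H K₁ K₂) N := by
  obtain ⟨u, v, huv⟩ := hH.exists_adj
  have := Fintype.ofFinite W
  have := Fintype.ofFinite A
  have := Fintype.ofFinite B
  have := Fintype.ofFinite H.edgeSet
  have := Fintype.ofFinite (outerEdges K₁)
  have := Fintype.ofFinite (outerEdges K₂)
  have hcard : Fintype.card (H.edgeSet ⊕ Fin 3) = Fintype.card (W × Fin 2) := by
    have := hH.1
    rw [← Nat.card_coe_set_eq, Nat.card_eq_fintype_card, Nat.card_eq_fintype_card] at this
    simp only [Fintype.card_sum, Fintype.card_prod, Fintype.card_fin]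
    omega
  obtain ⟨N, hN, hgen⟩ := exists_generic_glued_count hcard isPolyFun_baseMap isPolyFun_outerMap
    isPolyFun_outerMap h0 (generic_baseMap_of_isGenericCount huv ch)
    (generic_outerMap_of_isGenericCount huv h₁ c₁) (generic_outerMap_of_isGenericCount huv h₂ c₂)
  refine ⟨N, hN, ?_⟩
  rw [isGenericCount_iff (glue_adj_inl huv) gluedEdge_injective range_gluedEdge]
  refine (hgen.comp_injective (sumSwapRight_injective _ _ _)).mono fun t ht => ?_
  rw [← ht]
  let φ : Realization (W ⊕ (A ⊕ B)) ≃
      (W × Fin 2 → ℂ) × ((A × Fin 2 → ℂ) × (B × Fin 2 → ℂ)) :=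
    (Equiv.sumArrowEquivProdArrow W (A ⊕ B) (Fin 2 → ℂ)).trans
      (Equiv.prodCongr (Equiv.curry _ _ _).symm (sumRealizationEquiv A B))
  symm
  refine ENat.card_congr (Equiv.subtypeEquiv φ.symm fun z => ?_)
  have hz : φ.symm z = Sum.elim (Function.curry z.1)
      (Sum.elim (Function.curry z.2.1) (Function.curry z.2.2)) := rfl
  have hz₁ : φ.symm z ∘ leftIncl = Sum.elim (Function.curry z.1) (Function.curry z.2.1) := by
    rw [hz]
    funext x
    rcases x with x | x <;> rfl
  have hz₂ : φ.symm z ∘ rightIncl = Sum.elim (Function.curry z.1) (Function.curry z.2.2) := by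
    rw [hz]
    funext x
    rcases x with x | x <;> rfl
  rw [baseMap_eq_iff, Sum.forall, Sum.forall]
  simp only [gluedEdge, Sum.elim_inl, Sum.elim_inr, ← sqLen_comp, hz₁, hz₂]
  rw [hz]
  simp only [Sum.elim_comp_inl, funext_iff (f := outerMap _ _ _)]
  exact and_right_comm

end Glue

/-! ### Gluing along embedded subgraphs -/

/-- The vertex set of a graph, split along the image of an injective map. -/
noncomputable def sumComplEquiv {W V : Type*} (f : W → V) (hf : Function.Injective f) :
    W ⊕ ((Set.range f)ᶜ : Set V) ≃ V := by
  classical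
  exact (Equiv.sumCongr (Equiv.ofInjective f hf) (Equiv.refl _)).trans (Equiv.Set.sumCompl _)

theorem sumComplEquiv_inl {W V : Type*} (f : W → V) (hf : Function.Injective f) (w : W) :
    sumComplEquiv f hf (Sum.inl w) = f w := by
  simp [sumComplEquiv]

/-- Two Laman graphs with a common Laman subgraph can be glued along it. -/
theorem exists_glued_graph {W V₁ V₂ : Type*} [Finite W] [Finite V₁] [Finite V₂]
    {H : SimpleGraph W} {G₁ : SimpleGraph V₁} {G₂ : SimpleGraph V₂} (hH : IsLaman H)
    (hG₁ : IsLaman G₁) (hG₂ : IsLaman G₂) (f₁ : H →g G₁) (hf₁ : Function.Injective f₁)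
    (f₂ : H →g G₂) (hf₂ : Function.Injective f₂) {h g₁ g₂ : ℕ} (h0 : h ≠ 0)
    (ch : IsGenericCount H h) (c₁ : IsGenericCount G₁ g₁) (c₂ : IsGenericCount G₂ g₂)
    {n : ℕ} (hn : n + Nat.card W = Nat.card V₁ + Nat.card V₂) :
    ∃ (K : SimpleGraph (Fin n)) (N : ℕ), IsLaman K ∧ (∃ f : H →g K, Function.Injective f) ∧
      h * N = g₁ * g₂ ∧ IsGenericCount K N := by
  let e₁ := sumComplEquiv f₁ hf₁
  let e₂ := sumComplEquiv f₂ hf₂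
  let i₁ : G₁ ≃g G₁.comap e₁ := (SimpleGraph.Iso.comap e₁ G₁).symm
  let i₂ : G₂ ≃g G₂.comap e₂ := (SimpleGraph.Iso.comap e₂ G₂).symm
  -- Equality, not mere containment, holds because Laman subgraphs are induced.
  have r₁ : (G₁.comap e₁).comap Sum.inl = H := by
    ext a b
    simp only [SimpleGraph.comap_adj, e₁, sumComplEquiv_inl]
    exact ⟨hH.adj_of_adj_map hG₁ f₁ hf₁, f₁.map_adj⟩
  have r₂ : (G₂.comap e₂).comap Sum.inl = H := by
    ext a b
    simp only [SimpleGraph.comap_adj, e₂, sumComplEquiv_inl]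
    exact ⟨hH.adj_of_adj_map hG₂ f₂ hf₂, f₂.map_adj⟩
  obtain ⟨_, _, a₁⟩ := hG₁.exists_adj
  obtain ⟨_, _, a₂⟩ := hG₂.exists_adj
  obtain ⟨N, hN, cN⟩ := exists_isGenericCount_glue hH r₁ r₂ h0 ch (c₁.of_iso i₁ a₁)
    (c₂.of_iso i₂ a₂)
  have hL := isLaman_glue hH (hG₁.of_iso i₁) (hG₂.of_iso i₂) r₁ r₂
  have hcard : Nat.card (W ⊕ (((Set.range f₁)ᶜ : Set V₁) ⊕ ((Set.range f₂)ᶜ : Set V₂))) = n := by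
    have k₁ := Nat.card_congr e₁
    have k₂ := Nat.card_congr e₂
    rw [Nat.card_sum] at k₁ k₂ ⊢
    rw [Nat.card_sum]
    omega
  let e := Finite.equivFinOfCardEq hcard
  let i := SimpleGraph.Iso.map e (glue H (G₁.comap e₁) (G₂.comap e₂))
  obtain ⟨_, _, a⟩ := hL.exists_adj
  refine ⟨_, N, hL.of_iso i, ⟨⟨fun w => i (Sum.inl w), fun hab => ?_⟩, ?_⟩, hN, cN.of_iso i a⟩
  · exact i.map_adj_iff.mpr (glue_adj_inl hab)
  · exact i.injective.comp Sum.inl_injective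

/-! ### The edge and the triangle -/

theorem isLaman_top {V : Type*} [Finite V] (hV : Nat.card V = 2 ∨ Nat.card V = 3) :
    IsLaman (⊤ : SimpleGraph V) := by
  classical
  have := Fintype.ofFinite V
  have hE : (⊤ : SimpleGraph V).edgeSet.ncard = (Nat.card V).choose 2 := by
    rw [← SimpleGraph.coe_edgeFinset, Set.ncard_coe_finset,
      SimpleGraph.card_edgeFinset_top_eq_card_choose_two, Nat.card_eq_fintype_card]
  rw [isLaman_iff]
  refine ⟨by rcases hV with h | h <;> rw [hE, h] <;> rfl, fun S E hES hS hc => ?_⟩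
  have hle : S.ncard ≤ Nat.card V := Set.ncard_le_card S
  rcases eq_or_lt_of_le hc with h2 | h2
  · obtain ⟨a, b, hab, rfl⟩ := Set.ncard_eq_two.mp h2.symm
    have hsub : E ⊆ {s(a, b)} := by
      intro e he
      have h1 := hS e he
      have h3 : ¬ e.IsDiag := SimpleGraph.not_isDiag_of_mem_edgeSet _ (hES he)
      induction e with | _ x y =>
      have hx := h1 x (Sym2.mem_mk_left _ _)
      have hy := h1 y (Sym2.mem_mk_right _ _)
      rw [Sym2.mk_isDiag_iff] at h3
      rcases hx with rfl | rfl <;> rcases hy with rfl | rfl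
      · exact absurd rfl h3
      · rfl
      · exact Sym2.eq_swap
      · exact absurd rfl h3
    have := Set.ncard_le_ncard hsub
    rw [Set.ncard_singleton] at this
    omega
  · have h3 : Nat.card V = 3 := by omega
    have := Set.ncard_le_ncard hES
    rw [hE, h3] at this
    have h4 : Nat.choose 3 2 = 3 := rfl
    omega

/-- The point whose difference from `o` has isotropic coordinates `x` and `y`. -/
noncomputable def isotropicPoint (o : Fin 2 → ℂ) (x y : ℂ) : Fin 2 → ℂ :=
  ![o 0 + (x + y) / 2, o 1 - Complex.I * (x - y) / 2]

theorem eq_isotropicPoint_iff {o p : Fin 2 → ℂ} {x y : ℂ} :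
    p = isotropicPoint o x y ↔ (p 0 - o 0) + Complex.I * (p 1 - o 1) = x ∧
      (p 0 - o 0) - Complex.I * (p 1 - o 1) = y := by
  have hI := Complex.I_sq
  constructor
  · rintro rfl
    simp only [isotropicPoint, Matrix.cons_val_zero, Matrix.cons_val_one]
    constructor
    · linear_combination (-(x - y) / 2) * hI
    · linear_combination ((x - y) / 2) * hI
  · rintro ⟨rfl, rfl⟩
    funext i
    fin_cases i
    · simp [isotropicPoint]
    · simp only [isotropicPoint, Fin.mk_one, Matrix.cons_val_one, Matrix.cons_val_fin_one]
      linear_combination (p 1 - o 1) * hI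

theorem mul_eq_iff_of_ne_zero {x y a : ℂ} (hx : x ≠ 0) : x * y = a ↔ y = a / x := by
  rw [eq_div_iff hx, mul_comm]

/-- The anchor fixes vertex 0 and one isotropic coordinate of vertex 1; if that coordinate is
nonzero, the length determines the other. -/
theorem isGenericCount_edge : IsGenericCount (⊤ : SimpleGraph (Fin 2)) 1 := by
  have hr : Set.range (fun _ : Unit => s((0 : Fin 2), 1)) = (⊤ : SimpleGraph (Fin 2)).edgeSet := by
    ext e
    induction e with | _ a b =>
    fin_cases a <;> fin_cases b <;> simp
  rw [isGenericCount_iff (show (⊤ : SimpleGraph (Fin 2)).Adj 0 1 by simp)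
    (Function.injective_of_subsingleton _) hr]
  refine (Generic.apply_ne_zero (Sum.inr 2)).mono fun t ht => ?_
  set o : Fin 2 → ℂ := ![t (Sum.inr 0), t (Sum.inr 1)] with ho
  have key (ρ : Realization (Fin 2)) : ((∀ _ : Unit, sqLen ρ s(0, 1) = t (Sum.inl ())) ∧
      anchor 0 1 ρ = t ∘ Sum.inr) ↔
      ρ = ![o, isotropicPoint o (t (Sum.inr 2)) (t (Sum.inl ()) / t (Sum.inr 2))] := by
    have h1 : ρ = ![o, isotropicPoint o (t (Sum.inr 2)) (t (Sum.inl ()) / t (Sum.inr 2))] ↔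
        ρ 0 = o ∧
          ρ 1 = isotropicPoint o (t (Sum.inr 2)) (t (Sum.inl ()) / t (Sum.inr 2)) := by
      rw [funext_iff, Fin.forall_fin_two]
      rfl
    have h2 : ρ 0 = o ↔ ρ 0 0 = t (Sum.inr 0) ∧ ρ 0 1 = t (Sum.inr 1) := by
      rw [funext_iff, Fin.forall_fin_two]
      rfl
    rw [h1, anchor_eq_iff, sqLen_eq_isotropic, forall_const]
    simp only [Function.comp_apply]
    constructor
    · rintro ⟨h3, h4, h5, h6⟩
      have h7 := h2.mpr ⟨h4, h5⟩
      refine ⟨h7, ?_⟩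
      rw [h6, mul_eq_iff_of_ne_zero ht] at h3
      rw [← h7, eq_isotropicPoint_iff]
      exact ⟨h6, h3⟩
    · rintro ⟨h3, h4⟩
      rw [← h3, eq_isotropicPoint_iff] at h4
      obtain ⟨h5, h6⟩ := h2.mp h3
      refine ⟨?_, h5, h6, h4.1⟩
      rw [h4.1, h4.2, mul_div_cancel₀ _ ht]
  simp only [key]
  simp

/-- With vertices 0 and 1 determined and `x` an isotropic coordinate of vertex 2, the third length
reads `(x - s) * (b / x - a / s) = c`, a quadratic in `x`. Off its discriminant `D` there are two
roots. -/
theorem isGenericCount_triangle : IsGenericCount (⊤ : SimpleGraph (Fin 3)) 2 := by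
  let ε : Fin 3 → Sym2 (Fin 3) := ![s(0, 1), s(0, 2), s(1, 2)]
  have hε : Function.Injective ε := by decide
  have hr : Set.range ε = (⊤ : SimpleGraph (Fin 3)).edgeSet := by
    ext e
    have : ∀ e : Sym2 (Fin 3), (∃ i, ε i = e) ↔ ¬ e.IsDiag := by decide
    rw [SimpleGraph.edgeSet_top]
    exact this e
  rw [isGenericCount_iff (show (⊤ : SimpleGraph (Fin 3)).Adj 0 1 by simp) hε hr]
  let D : MvPolynomial (Fin 3 ⊕ Fin 3) ℂ :=
    (MvPolynomial.X (Sum.inl 0) + MvPolynomial.X (Sum.inl 1) - MvPolynomial.X (Sum.inl 2)) ^ 2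
      - 4 * MvPolynomial.X (Sum.inl 0) * MvPolynomial.X (Sum.inl 1)
  have hD : D ≠ 0 := by
    intro h
    -- At lengths 0, 0, 1 the discriminant equals 1.
    have := congrArg (MvPolynomial.eval (Sum.elim ![0, 0, 1] 0)) h
    simp [D] at this
  refine ((Generic.of_eval_ne_zero hD).and ((Generic.apply_ne_zero (Sum.inl 0)).and
    ((Generic.apply_ne_zero (Sum.inl 1)).and (Generic.apply_ne_zero (Sum.inr 2))))).mono ?_
  rintro t ⟨hdisc, ha, hb, hs⟩
  simp only [D, map_sub, map_mul, map_pow, map_add, MvPolynomial.eval_X, map_ofNat] at hdisc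
  have hall (ρ : Realization (Fin 3)) : (∀ e, sqLen ρ (ε e) = t (Sum.inl e)) ↔
      sqLen ρ s(0, 1) = t (Sum.inl 0) ∧ sqLen ρ s(0, 2) = t (Sum.inl 1) ∧
        sqLen ρ s(1, 2) = t (Sum.inl 2) := by
    rw [Fin.forall_fin_succ, Fin.forall_fin_two]
    rfl
  simp only [hall, anchor_eq_iff, Function.comp_apply]
  generalize t (Sum.inl 0) = a at *
  generalize t (Sum.inl 1) = b at *
  generalize t (Sum.inl 2) = c at *
  generalize t (Sum.inr 2) = s at *
  set o : Fin 2 → ℂ := ![t (Sum.inr 0), t (Sum.inr 1)] with ho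
  let R (x : ℂ) : Realization (Fin 3) := ![o, isotropicPoint o s (a / s), isotropicPoint o x (b / x)]
  obtain ⟨δ, hδ⟩ := IsAlgClosed.exists_eq_mul_self ((a + b - c) ^ 2 - 4 * a * b)
  have hδ0 : δ ≠ 0 := by
    rintro rfl
    exact hdisc (by rw [hδ, mul_zero])
  have has : a / s ≠ 0 := div_ne_zero ha hs
  have hquad (x : ℂ) : (a / s) * (x * x) + (-(a + b - c)) * x + s * b = 0 ↔
      x = (a + b - c + δ) / (2 * (a / s)) ∨ x = (a + b - c - δ) / (2 * (a / s)) := by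
    rw [quadratic_eq_zero_iff (s := δ) has, neg_neg]
    rw [discrim, ← hδ]
    field_simp
  have key (ρ : Realization (Fin 3)) :
      ((sqLen ρ s(0, 1) = a ∧ sqLen ρ s(0, 2) = b ∧ sqLen ρ s(1, 2) = c) ∧
        ρ 0 0 = t (Sum.inr 0) ∧ ρ 0 1 = t (Sum.inr 1) ∧
        (ρ 1 0 - ρ 0 0) + Complex.I * (ρ 1 1 - ρ 0 1) = s) ↔
      ∃ x, (a / s) * (x * x) + (-(a + b - c)) * x + s * b = 0 ∧ ρ = R x := by
    have hR (x : ℂ) : ρ = R x ↔ ρ 0 = o ∧ ρ 1 = isotropicPoint o s (a / s) ∧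
        ρ 2 = isotropicPoint o x (b / x) := by
      rw [funext_iff, Fin.forall_fin_succ, Fin.forall_fin_two]
      rfl
    have h2 : ρ 0 = o ↔ ρ 0 0 = t (Sum.inr 0) ∧ ρ 0 1 = t (Sum.inr 1) := by
      rw [funext_iff, Fin.forall_fin_two]
      rfl
    simp only [hR, sqLen_eq_isotropic]
    constructor
    · rintro ⟨⟨e1, e2, e3⟩, h4, h5, h6⟩
      have h7 := h2.mpr ⟨h4, h5⟩
      rw [h6, mul_eq_iff_of_ne_zero hs] at e1
      have hx := left_ne_zero_of_mul (e2 ▸ hb)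
      have e4 := (mul_eq_iff_of_ne_zero hx).mp e2
      refine ⟨(ρ 2 0 - ρ 0 0) + Complex.I * (ρ 2 1 - ρ 0 1), ?_, h7, ?_, ?_⟩
      · have e1' : ((ρ 1 0 - ρ 0 0) - Complex.I * (ρ 1 1 - ρ 0 1)) * s = a := by
          rw [e1, div_mul_cancel₀ _ hs]
        rw [← e1]
        generalize hp : ρ 2 0 - ρ 0 0 = p at *
        generalize hq : ρ 2 1 - ρ 0 1 = q at *
        generalize hm : ρ 1 0 - ρ 0 0 = m at *
        generalize hn : ρ 1 1 - ρ 0 1 = n at *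
        have i1 : ρ 2 0 - ρ 1 0 = p - m := by rw [← hp, ← hm]; ring
        have i2 : ρ 2 1 - ρ 1 1 = q - n := by rw [← hq, ← hn]; ring
        rw [i1, i2] at e3
        subst h6
        linear_combination -(p + Complex.I * q) * e3 + (p + Complex.I * q) * e1' +
          ((p + Complex.I * q) - (m + Complex.I * n)) * e2
      · rw [← h7, eq_isotropicPoint_iff]
        exact ⟨h6, e1⟩
      · rw [← h7, eq_isotropicPoint_iff]
        exact ⟨rfl, e4⟩
    · rintro ⟨x, hx, h3, h4, h5⟩
      -- The constant term `s * b` is nonzero, so no root introduced by clearing the denominator `x`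
      -- is spurious.
      have hx0 : x ≠ 0 := by
        rintro rfl
        simp [hs, hb] at hx
      rw [← h3, eq_isotropicPoint_iff] at h4 h5
      obtain ⟨h6, h7⟩ := h2.mp h3
      refine ⟨⟨?_, ?_, ?_⟩, h6, h7, h4.1⟩
      · rw [h4.1, h4.2, mul_div_cancel₀ _ hs]
      · rw [h5.1, h5.2, mul_div_cancel₀ _ hx0]
      · have i1 : (ρ 2 0 - ρ 1 0) + Complex.I * (ρ 2 1 - ρ 1 1) = x - s := by
          linear_combination h5.1 - h4.1
        have i2 : (ρ 2 0 - ρ 1 0) - Complex.I * (ρ 2 1 - ρ 1 1) = b / x - a / s := by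
          linear_combination h5.2 - h4.2
        rw [i1, i2]
        field_simp at hx ⊢
        linear_combination -hx
  simp only [key, hquad]
  set r₁ := (a + b - c + δ) / (2 * (a / s)) with hr₁
  set r₂ := (a + b - c - δ) / (2 * (a / s)) with hr₂
  have hne : r₁ ≠ r₂ := by
    intro h
    rw [hr₁, hr₂, div_left_inj' (mul_ne_zero two_ne_zero has)] at h
    exact hδ0 (by linear_combination h / 2)
  have hR : R r₁ ≠ R r₂ := by
    intro h
    have h1 := (eq_isotropicPoint_iff (o := o) (p := R r₁ 2)).mp rfl
    have h2 := (eq_isotropicPoint_iff (o := o) (p := R r₂ 2)).mp rfl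
    rw [h] at h1
    exact hne (h1.1.symm.trans h2.1)
  have hset : {ρ | ∃ x, (x = r₁ ∨ x = r₂) ∧ ρ = R x} = {R r₁, R r₂} := by
    ext ρ
    simp
  have := Set.encard_pair hR
  rw [← hset] at this
  exact this

/-! ### Laman numbers and the lower bounds -/

theorem lam_eq_of_isGenericCount {V : Type*} {G : SimpleGraph V} {N : ℕ} (h : IsGenericCount G N) :
    lam G = N :=
  IsGenericCount.unique (Nat.sInf_mem (s := {N | IsGenericCount G N}) ⟨N, h⟩) h

/-- The infimum of the empty set is 0, so a nonzero value certifies that a generic count exists. -/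
theorem isGenericCount_lam {V : Type*} {G : SimpleGraph V} (h : lam G ≠ 0) :
    IsGenericCount G (lam G) :=
  Nat.sInf_mem (Nat.nonempty_of_pos_sInf (Nat.pos_of_ne_zero h))

theorem le_maxLam {n N : ℕ} {K : SimpleGraph (Fin n)} (hK : IsLaman K) (h : IsGenericCount K N) :
    N ≤ maxLam n :=
  le_csSup (finite_lamanNumbers n).bddAbove ⟨K, hK, lam_eq_of_isGenericCount h⟩

/-- An edge of a graph, as a homomorphism. -/
def edgeHom {V : Type*} {G : SimpleGraph V} {u v : V} (huv : G.Adj u v) :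
    (⊤ : SimpleGraph (Fin 2)) →g G where
  toFun := ![u, v]
  map_rel' := by
    intro a b hab
    fin_cases a <;> fin_cases b
    · exact absurd rfl hab
    · exact huv
    · exact huv.symm
    · exact absurd rfl hab

/-- Adding vertices of degree two doubles the number of realizations each time. -/
theorem exists_isGenericCount_two_pow_mul {m N : ℕ} {K : SimpleGraph (Fin m)} (hK : IsLaman K)
    (hN : IsGenericCount K N) (r : ℕ) :
    ∃ K' : SimpleGraph (Fin (m + r)), IsLaman K' ∧ IsGenericCount K' (2 ^ r * N) := by
  induction r with
  | zero => exact ⟨K, hK, by simpa using hN⟩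
  | succ r ih =>
    obtain ⟨K', hK', hN'⟩ := ih
    obtain ⟨u, v, huv⟩ := hK'.exists_adj
    let f₁ := edgeHom huv
    let f₂ : (⊤ : SimpleGraph (Fin 2)) →g (⊤ : SimpleGraph (Fin 3)) :=
      ⟨Fin.castSucc, fun hab => (Fin.castSucc_injective 2).ne hab⟩
    obtain ⟨L, M, hL, -, hM, cM⟩ := exists_glued_graph (n := m + (r + 1))
      (isLaman_top (Or.inl (by simp))) hK' (isLaman_top (Or.inr (by simp)))
      f₁ (SimpleGraph.Hom.injective_of_top_hom f₁) f₂ (SimpleGraph.Hom.injective_of_top_hom f₂)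
      one_ne_zero isGenericCount_edge hN' isGenericCount_triangle (by simp; ring)
    refine ⟨L, hL, ?_⟩
    rwa [show 2 ^ (r + 1) * N = M by rw [← one_mul M, hM]; ring]

/-- Gluing `q` copies of `G` along `H`. -/
theorem exists_isGenericCount_glued_copies {W V : Type*} [Finite W] [Finite V]
    {H : SimpleGraph W} {G : SimpleGraph V} (hH : IsLaman H) (hG : IsLaman G) (f : H →g G)
    (hf : Function.Injective f) {h g : ℕ} (h0 : h ≠ 0) (ch : IsGenericCount H h) (q : ℕ)
    (cg : q ≠ 0 → IsGenericCount G g) :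
    ∃ (K : SimpleGraph (Fin (Nat.card W + q * (Nat.card V - Nat.card W)))) (N : ℕ),
      IsLaman K ∧ (∃ f : H →g K, Function.Injective f) ∧ N * h ^ q = h * g ^ q ∧
        IsGenericCount K N := by
  induction q with
  | zero =>
    rw [zero_mul, add_zero]
    let i := SimpleGraph.Iso.map (Finite.equivFin W) H
    obtain ⟨_, _, a⟩ := hH.exists_adj
    exact ⟨_, h, hH.of_iso i, ⟨i.toHom, i.injective⟩, by simp, ch.of_iso i a⟩
  | succ q ih =>
    have cg := cg (Nat.succ_ne_zero q)
    obtain ⟨K, N, hK, ⟨f', hf'⟩, hN, cN⟩ := ih fun _ => cg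
    have hcard : Nat.card W ≤ Nat.card V := Nat.card_le_card_of_injective f hf
    obtain ⟨K', N', hK', hf'', hN', cN'⟩ := exists_glued_graph
      (n := Nat.card W + (q + 1) * (Nat.card V - Nat.card W)) hH hK hG f' hf' f hf h0 ch cN cg (by
        obtain ⟨d, hd⟩ := Nat.exists_eq_add_of_le hcard
        rw [hd, Nat.add_sub_cancel_left, Nat.card_fin]
        ring)
    refine ⟨K', N', hK', hf'', ?_, cN'⟩
    -- The invariant is kept free of division, so divisibility of `g` by `h` never has to be
    -- discussed.
    calc N' * h ^ (q + 1) = h * N' * h ^ q := by ring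
      _ = (N * h ^ q) * g := by rw [hN']; ring
      _ = h * g ^ (q + 1) := by rw [hN]; ring

/-- Common source of all three bounds: the quotient counts the glued copies, the remainder the added
vertices of degree two. -/
theorem le_maxLam_of_injective_hom {W V : Type*} [Finite W] [Finite V]
    {H : SimpleGraph W} {G : SimpleGraph V} (hH : IsLaman H) (hG : IsLaman G) (f : H →g G)
    (hf : Function.Injective f) {n : ℕ} (hn : Nat.card W ≤ n) :
    (2 : ℝ) ^ ((n - Nat.card W) % (Nat.card V - Nat.card W)) * (lam H : ℝ) *
        ((lam G : ℝ) / (lam H : ℝ)) ^ ((n - Nat.card W) / (Nat.card V - Nat.card W)) ≤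
      (maxLam n : ℝ) := by
  have hn' : Nat.card W + (n - Nat.card W) / (Nat.card V - Nat.card W) *
      (Nat.card V - Nat.card W) + (n - Nat.card W) % (Nat.card V - Nat.card W) = n := by
    have := Nat.div_add_mod' (n - Nat.card W) (Nat.card V - Nat.card W)
    omega
  generalize (n - Nat.card W) / (Nat.card V - Nat.card W) = q at *
  generalize (n - Nat.card W) % (Nat.card V - Nat.card W) = r at *
  by_cases h0 : lam H = 0
  · simp [h0]
  -- For `q = 0` no copy of `G` is used, so a vanishing `lam G` is harmless; for `q ≠ 0` it makes
  -- the left side 0.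
  by_cases hq : q ≠ 0 ∧ lam G = 0
  · simp [hq.1, hq.2]
  obtain ⟨K, N, hK, -, hN, cN⟩ := exists_isGenericCount_glued_copies hH hG f hf h0
    (isGenericCount_lam h0) q fun hq0 => isGenericCount_lam fun hg => hq ⟨hq0, hg⟩
  obtain ⟨K', hK', cN'⟩ := exists_isGenericCount_two_pow_mul hK cN r
  have hmax := le_maxLam hK' cN'
  rw [hn'] at hmax
  have hh : (lam H : ℝ) ≠ 0 := by exact_mod_cast h0
  have hN' : (N : ℝ) * (lam H : ℝ) ^ q = lam H * (lam G : ℝ) ^ q := by exact_mod_cast hN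
  have heq : (lam H : ℝ) * ((lam G : ℝ) / lam H) ^ q = N := by
    rw [div_pow, ← mul_div_assoc, div_eq_iff (pow_ne_zero q hh), hN']
  rw [mul_assoc, heq]
  exact_mod_cast hmax

end LamanCount

theorem mainTheorem3 {V : Type*} [Fintype V] (G : SimpleGraph V) (hG : LamanCount.IsLaman G) :
    (2 < Fintype.card V → ∀ n : ℕ, 2 ≤ n →
      2 ^ ((n - 2) % (Fintype.card V - 2)) *
          LamanCount.lam G ^ ((n - 2) / (Fintype.card V - 2))
        ≤ LamanCount.maxLam n) ∧
    ((∃ a b c : V, G.Adj a b ∧ G.Adj b c ∧ G.Adj a c) → 3 < Fintype.card V → ∀ n : ℕ, 3 ≤ n →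
      (2 : ℝ) ^ ((n - 3) % (Fintype.card V - 3)) * 2 *
          ((LamanCount.lam G : ℝ) / 2) ^ ((n - 3) / (Fintype.card V - 3))
        ≤ (LamanCount.maxLam n : ℝ)) ∧
    (∀ H : G.Subgraph, LamanCount.IsLaman H.coe → H.verts.ncard < Fintype.card V →
      ∀ n : ℕ, H.verts.ncard ≤ n →
      (2 : ℝ) ^ ((n - H.verts.ncard) % (Fintype.card V - H.verts.ncard)) *
          (LamanCount.lam H.coe : ℝ) *
          ((LamanCount.lam G : ℝ) / (LamanCount.lam H.coe : ℝ)) ^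
            ((n - H.verts.ncard) / (Fintype.card V - H.verts.ncard))
        ≤ (LamanCount.maxLam n : ℝ)) := by
  rw [← Nat.card_eq_fintype_card]
  refine ⟨fun _ n hn => ?_, ?_, fun H hH _ n hn => ?_⟩
  · obtain ⟨u, v, huv⟩ := hG.exists_adj
    let f := LamanCount.edgeHom huv
    have h := LamanCount.le_maxLam_of_injective_hom
      (LamanCount.isLaman_top (Or.inl (Nat.card_fin 2))) hG f
      (SimpleGraph.Hom.injective_of_top_hom f) (n := n) (by rwa [Nat.card_fin])
    rw [LamanCount.lam_eq_of_isGenericCount LamanCount.isGenericCount_edge, Nat.card_fin,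
      Nat.cast_one, mul_one, div_one] at h
    exact_mod_cast h
  · rintro ⟨a, b, c, hab, hbc, hac⟩ _ n hn
    let f : (⊤ : SimpleGraph (Fin 3)) →g G := ⟨![a, b, c], by
      intro i j hij
      fin_cases i <;> fin_cases j
      · exact absurd rfl hij
      · exact hab
      · exact hac
      · exact hab.symm
      · exact absurd rfl hij
      · exact hbc
      · exact hac.symm
      · exact hbc.symm
      · exact absurd rfl hij⟩
    have h := LamanCount.le_maxLam_of_injective_hom
      (LamanCount.isLaman_top (Or.inr (Nat.card_fin 3))) hG f
      (SimpleGraph.Hom.injective_of_top_hom f) (n := n) (by rwa [Nat.card_fin])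
    rwa [LamanCount.lam_eq_of_isGenericCount LamanCount.isGenericCount_triangle,
      Nat.card_fin, Nat.cast_ofNat] at h
  · exact LamanCount.le_maxLam_of_injective_hom hH hG H.hom H.hom_injective hn
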